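/- Let $\mathbb K=\mathbb R$ or $\mathbb C$. A symplectic Lie algebra is a Lie algebra $\mathfrak g$ over $\mathbb K$ admitting a nondegenerate skew-symmetric bilinear form $\theta$ with $\theta([X,Y],Z)+\theta([Y,Z],X)+\theta([Z,X],Y)=0$ for all $X,Y,Z$. It is $2$-step nilpotent if $[\mathfrak g,[\mathfrak g,\mathfrak g]]=0\neq[\mathfrak g,\mathfrak g]$. The characteristic sequence of a nilpotent Lie algebra $\mathfrak g$ is the maximum, for the lexicographic order, over $X\in\mathfrak g\setminus[\mathfrak g,\mathfrak g]$, of the decreasing sequence of the dimensions of the Jordan blocks of $\operatorname{ad}X$. A Lie algebra is decomposable if it is the direct product of two nonzero ideals. In the following list the brackets that are not given and do not follow by skew-symmetry are zero: - $\mathfrak n_3^1$, with basis $X_1,\dots,X_3$: $[X_1,X_2]=X_3$; - $\mathfrak n_5^5$, with basis $X_1,\dots,X_5$: $[X_1,X_2]=X_3$, $[X_1,X_4]=X_5$; - $\mathfrak n_6^{19}$, with basis $X_1,\dots,X_6$: $[X_1,X_2]=X_3$, $[X_1,X_4]=X_5$, $[X_2,X_6]=X_5$; - $\mathfrak n_6^{20}$,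 with basis $X_1,\dots,X_6$: $[X_1,X_2]=X_3$, $[X_1,X_4]=X_5$, $[X_2,X_4]=X_6$; - $\mathfrak n_6^{20,1}$, with basis $X_1,\dots,X_6$: $[X_1,X_2]=X_3$, $[X_4,X_6]=X_3$, $[X_1,X_4]=X_5$, $[X_2,X_6]=-X_5$; - $\mathfrak n_7^{124}$, with basis $X_1,\dots,X_7$: $[X_1,X_2]=X_3$, $[X_4,X_7]=X_3$, $[X_1,X_4]=X_5$, $[X_6,X_7]=X_5$. Write $\mathbb K^m$ for the abelian Lie algebra of dimension $m$, and $\oplus$ for the direct product of Lie algebras. **Theorem.** 1. Every $8$-dimensional $2$-step nilpotent symplectic Lie algebra over $\mathbb K$ with characteristic sequence $(2,2,1,1,1,1)$ is decomposable. 2. In particular, let $\mathcal C_1(\mathcal F^{8,2}_{2,4})$ be the family of the $8$-dimensional Lie algebras over $\mathbb K$ having a basis $X_1,\dots,X_8$ such that $[X_1,X_2]=X_3$, $[X_1,X_4]=X_5$, $[X_1,X_i]=0$ for $i=6,7,8$, $[X_i,X_j]\in\mathbb K X_3+\mathbb K X_5$ for $i,j\in\{2,4,6,7,8\}$, and $X_3,X_5$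 are central. Every symplectic Lie algebra in this family is decomposable. 3. A complex Lie algebra is $8$-dimensional, $2$-step nilpotent and symplectic with characteristic sequence $(2,2,1,1,1,1)$ if and only if it is isomorphic to one of $$\mathfrak n_7^{124}\oplus\mathbb C,\quad \mathfrak n_6^{19}\oplus\mathbb C^2,\quad \mathfrak n_6^{20}\oplus\mathbb C^2,\quad \mathfrak n_5^5\oplus\mathbb C^3,\quad \mathfrak n_3^1\oplus\mathfrak n_3^1\oplus\mathbb C^2.$$ 4. A real Lie algebra is $8$-dimensional, $2$-step nilpotent and symplectic with characteristic sequence $(2,2,1,1,1,1)$ if and only if it is isomorphic to one of $$\mathfrak n_7^{124}\oplus\mathbb R,\quad \mathfrak n_6^{19}\oplus\mathbb R^2,\quad \mathfrak n_6^{20}\oplus\mathbb R^2,\quad \mathfrak n_6^{20,1}\oplus\mathbb R^2,\quad \mathfrak n_5^5\oplus\mathbb R^3,\quad \mathfrak n_3^1\oplus\mathfrak n_3^1\oplus\mathbb R^2.$$ -/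

import Mathlib

namespace SympLie

/-! ### Symplectic Lie algebras, nilindex, decomposability -/

section General

variable (K : Type*) [Field K] (L : Type*) [LieRing L] [LieAlgebra K L]

/-- A symplectic form on a Lie algebra: a nondegenerate alternating bilinear form that is closed for
the Chevalley-Eilenberg differential. -/
def IsSymplecticForm (θ : LinearMap.BilinForm K L) : Prop :=
  θ.IsAlt ∧ θ.Nondegenerate ∧
    ∀ x y z : L, θ ⁅x, y⁆ z + θ ⁅y, z⁆ x + θ ⁅z, x⁆ y = 0

/-- A Lie algebra is symplectic if it admits a symplectic form. -/
def IsSymplectic : Prop := ∃ θ : LinearMap.BilinForm K L, IsSymplecticForm K L θ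

/-- Nilindex exactly `2`: `C^2(L) = 0` and `C^1(L) ≠ 0` in the lower central series. -/
def IsTwoStepNilpotent : Prop :=
  LieModule.lowerCentralSeries K L L 2 = ⊥ ∧ LieModule.lowerCentralSeries K L L 1 ≠ ⊥

/-- A Lie algebra is decomposable if it is the direct product of two nonzero ideals. -/
def IsDecomposable : Prop :=
  ∃ I J : LieIdeal K L, I ≠ ⊥ ∧ J ≠ ⊥ ∧ IsCompl I J

variable {K} in
/-- `s` is the decreasing sequence of the dimensions of the Jordan blocks of the nilpotent
endomorphism `f`: the space has a basis `b i j`, with `i` the number of the block and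
`0 ≤ j < s i`, such that `f (b i 0) = 0` and `f (b i (j + 1)) = b i j`. -/
def IsJordanSequence {V : Type*} [AddCommGroup V] [Module K V] (f : V →ₗ[K] V) (s : List ℕ) :
    Prop :=
  s.Pairwise (· ≥ ·) ∧ (∀ m ∈ s, 0 < m) ∧
    ∃ b : Module.Basis (Σ i : Fin s.length, Fin (s.get i)) K V,
      ∀ (i : Fin s.length) (j : ℕ) (hj : j < s.get i),
        (j = 0 → f (b ⟨i, ⟨j, hj⟩⟩) = 0) ∧
        (∀ hj' : j + 1 < s.get i, f (b ⟨i, ⟨j + 1, hj'⟩⟩) = b ⟨i, ⟨j, hj⟩⟩)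

/-- `s` is the characteristic sequence of the nilpotent Lie algebra `L`: the greatest, for the
lexicographic order, of the Jordan sequences of `ad X`, where `X` lies outside `C^1(L)`. -/
def IsCharSequence (s : List ℕ) : Prop :=
  IsGreatest {t : List ℕ | ∃ x : L, x ∉ LieModule.lowerCentralSeries K L L 1 ∧
    IsJordanSequence (LieAlgebra.ad K L x) t} s

/-- The hypotheses on the Lie algebra: it has dimension `8`, is `2`-step nilpotent, is symplectic
and has characteristic sequence `(2,2,1,1,1,1)`. -/
def IsSymplecticOfType221111 : Prop :=
  Module.finrank K L = 8 ∧ IsTwoStepNilpotent K L ∧ IsSymplectic K L ∧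
    IsCharSequence K L [2, 2, 1, 1, 1, 1]

/-- Membership in the component `C₁` of the family of `8`-dimensional `2`-step nilpotent Lie
algebras with characteristic sequence `(2,2,1,1,1,1)` (those with `6` generators): there is a basis
`X₁, …, X₈` (here `X (i - 1)` stands for `X_i`) with `[X₁,X₂] = X₃`, `[X₁,X₄] = X₅`,
`[X₁,X_i] = 0` for `i = 6,7,8`, `[X_i,X_j] = a_{ij}^3 X₃ + a_{ij}^5 X₅` for
`i,j ∈ {2,4,6,7,8}`, and `X₃`, `X₅` central. -/
def IsInComponentOne : Prop :=
  ∃ (X : Module.Basis (Fin 8) K L) (a₃ a₅ : Fin 8 → Fin 8 → K),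
    ⁅X 0, X 1⁆ = X 2 ∧ ⁅X 0, X 3⁆ = X 4 ∧
    (∀ i ∈ ({5, 6, 7} : Set (Fin 8)), ⁅X 0, X i⁆ = 0) ∧
    (∀ i ∈ ({1, 3, 5, 6, 7} : Set (Fin 8)), ∀ j ∈ ({1, 3, 5, 6, 7} : Set (Fin 8)),
      ⁅X i, X j⁆ = a₃ i j • X 2 + a₅ i j • X 4) ∧
    (∀ i, ⁅X 2, X i⁆ = 0) ∧ (∀ i, ⁅X 4, X i⁆ = 0)

end General

/-! ### The Lie algebras of the list -/

/-- An alternating bilinear bracket on `K^n` all of whose double brackets vanish. -/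
structure BracketTable (K : Type*) [Field K] (n : ℕ) where
  br : (Fin n → K) → (Fin n → K) → (Fin n → K)
  add_left : ∀ x y z, br (x + y) z = br x z + br y z
  add_right : ∀ x y z, br x (y + z) = br x y + br x z
  smul_right : ∀ (c : K) x y, br x (c • y) = c • br x y
  self : ∀ x, br x x = 0
  nil : ∀ x y z, br x (br y z) = 0

namespace BracketTable

variable {K : Type*} [Field K] {n : ℕ}

/-- The Lie algebra with underlying space `K^n` and the given bracket. -/
def Alg (_D : BracketTable K n) : Type _ := Fin n → K

variable (D : BracketTable K n)

instance : AddCommGroup D.Alg := inferInstanceAs (AddCommGroup (Fin n → K))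

instance : Module K D.Alg := inferInstanceAs (Module K (Fin n → K))

theorem br_skew (x y : Fin n → K) : D.br x y = -D.br y x := by
  have h := D.self (x + y)
  rw [D.add_left, D.add_right, D.add_right, D.self, D.self, zero_add, add_zero] at h
  exact eq_neg_of_add_eq_zero_left h

theorem br_leibniz (x y z : Fin n → K) :
    D.br x (D.br y z) = D.br (D.br x y) z + D.br y (D.br x z) := by
  rw [D.br_skew (D.br x y) z, D.nil, D.nil, D.nil, neg_zero, add_zero]

instance : LieRing D.Alg where
  bracket x y := D.br x y
  add_lie := D.add_left
  lie_add := D.add_right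
  lie_self := D.self
  leibniz_lie := D.br_leibniz

instance : LieAlgebra K D.Alg where
  lie_smul := D.smul_right

end BracketTable

section Models

variable (K : Type*) [Field K]

/-- The abelian Lie algebra `K^m`. -/
def abelianTable (m : ℕ) : BracketTable K m where
  br _ _ := 0
  add_left _ _ _ := (add_zero 0).symm
  add_right _ _ _ := (add_zero 0).symm
  smul_right c _ _ := (smul_zero c).symm
  self _ := rfl
  nil _ _ _ := rfl

/-- `n_3^1`, the Heisenberg algebra: `[X₁,X₂] = X₃`. Here and below the coordinate number `i - 1`
is the coefficient of `X_i`. -/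
def n3_1Table : BracketTable K 3 where
  br x y := ![0, 0, x 0 * y 1 - x 1 * y 0]
  add_left x y z := by ext i; fin_cases i <;> simp; ring
  add_right x y z := by ext i; fin_cases i <;> simp; ring
  smul_right c x y := by ext i; fin_cases i <;> simp; ring
  self x := by ext i; fin_cases i <;> simp; ring
  nil x y z := by ext i; fin_cases i <;> simp

/-- `n_5^5`: `[X₁,X₂] = X₃`, `[X₁,X₄] = X₅`. -/
def n5_5Table : BracketTable K 5 where
  br x y := ![0, 0, x 0 * y 1 - x 1 * y 0, 0, x 0 * y 3 - x 3 * y 0]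
  add_left x y z := by ext i; fin_cases i <;> simp <;> ring
  add_right x y z := by ext i; fin_cases i <;> simp <;> ring
  smul_right c x y := by ext i; fin_cases i <;> simp <;> ring
  self x := by ext i; fin_cases i <;> simp <;> ring
  nil x y z := by ext i; fin_cases i <;> simp

/-- `n_6^19`: `[X₁,X₂] = X₃`, `[X₁,X₄] = X₅`, `[X₂,X₆] = X₅`. -/
def n6_19Table : BracketTable K 6 where
  br x y := ![0, 0, x 0 * y 1 - x 1 * y 0, 0,
    (x 0 * y 3 - x 3 * y 0) + (x 1 * y 5 - x 5 * y 1), 0]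
  add_left x y z := by ext i; fin_cases i <;> simp <;> ring
  add_right x y z := by ext i; fin_cases i <;> simp <;> ring
  smul_right c x y := by ext i; fin_cases i <;> simp <;> ring
  self x := by ext i; fin_cases i <;> simp <;> ring
  nil x y z := by ext i; fin_cases i <;> simp

/-- `n_6^20`: `[X₁,X₂] = X₃`, `[X₁,X₄] = X₅`, `[X₂,X₄] = X₆`. -/
def n6_20Table : BracketTable K 6 where
  br x y := ![0, 0, x 0 * y 1 - x 1 * y 0, 0, x 0 * y 3 - x 3 * y 0, x 1 * y 3 - x 3 * y 1]
  add_left x y z := by ext i; fin_cases i <;> simp <;> ring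
  add_right x y z := by ext i; fin_cases i <;> simp <;> ring
  smul_right c x y := by ext i; fin_cases i <;> simp <;> ring
  self x := by ext i; fin_cases i <;> simp <;> ring
  nil x y z := by ext i; fin_cases i <;> simp

/-- `n_6^{20,1}`: `[X₁,X₂] = X₃`, `[X₄,X₆] = X₃`, `[X₁,X₄] = X₅`, `[X₂,X₆] = -X₅`. -/
def n6_20_1Table : BracketTable K 6 where
  br x y := ![0, 0, (x 0 * y 1 - x 1 * y 0) + (x 3 * y 5 - x 5 * y 3), 0,
    (x 0 * y 3 - x 3 * y 0) - (x 1 * y 5 - x 5 * y 1), 0]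
  add_left x y z := by ext i; fin_cases i <;> simp <;> ring
  add_right x y z := by ext i; fin_cases i <;> simp <;> ring
  smul_right c x y := by ext i; fin_cases i <;> simp <;> ring
  self x := by ext i; fin_cases i <;> simp <;> ring
  nil x y z := by ext i; fin_cases i <;> simp

/-- `n_7^124`: `[X₁,X₂] = X₃`, `[X₄,X₇] = X₃`, `[X₁,X₄] = X₅`, `[X₆,X₇] = X₅`. -/
def n7_124Table : BracketTable K 7 where
  br x y := ![0, 0, (x 0 * y 1 - x 1 * y 0) + (x 3 * y 6 - x 6 * y 3), 0,
    (x 0 * y 3 - x 3 * y 0) + (x 5 * y 6 - x 6 * y 5), 0, 0]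
  add_left x y z := by ext i; fin_cases i <;> simp <;> ring
  add_right x y z := by ext i; fin_cases i <;> simp <;> ring
  smul_right c x y := by ext i; fin_cases i <;> simp <;> ring
  self x := by ext i; fin_cases i <;> simp <;> ring
  nil x y z := by ext i; fin_cases i <;> simp

/-- The abelian Lie algebra `K^m`. -/
abbrev Ab (m : ℕ) : Type _ := (abelianTable K m).Alg

/-- The Lie algebra `n_3^1`. -/
abbrev N3_1 : Type _ := (n3_1Table K).Alg

/-- The Lie algebra `n_5^5`. -/
abbrev N5_5 : Type _ := (n5_5Table K).Alg

/-- The Lie algebra `n_6^19`. -/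
abbrev N6_19 : Type _ := (n6_19Table K).Alg

/-- The Lie algebra `n_6^20`. -/
abbrev N6_20 : Type _ := (n6_20Table K).Alg

/-- The Lie algebra `n_6^{20,1}`. -/
abbrev N6_20_1 : Type _ := (n6_20_1Table K).Alg

/-- The Lie algebra `n_7^124`. -/
abbrev N7_124 : Type _ := (n7_124Table K).Alg

variable (L : Type*) [LieRing L] [LieAlgebra K L]

/-- `L` is isomorphic to one of the five direct products `n_7^124 ⊕ K`, `n_6^19 ⊕ K^2`,
`n_6^20 ⊕ K^2`, `n_5^5 ⊕ K^3`, `n_3^1 ⊕ n_3^1 ⊕ K^2`. -/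
def IsInCommonList : Prop :=
  Nonempty (L ≃ₗ⁅K⁆ N7_124 K × Ab K 1) ∨
  Nonempty (L ≃ₗ⁅K⁆ N6_19 K × Ab K 2) ∨
  Nonempty (L ≃ₗ⁅K⁆ N6_20 K × Ab K 2) ∨
  Nonempty (L ≃ₗ⁅K⁆ N5_5 K × Ab K 3) ∨
  Nonempty (L ≃ₗ⁅K⁆ N3_1 K × N3_1 K × Ab K 2)

end Models

end SympLie

namespace SympLie

/-! ### Linear algebra -/

section LinearAlgebra

open Module

variable {K V : Type*} [Field K] [AddCommGroup V] [Module K V] [FiniteDimensional K V]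

/-! In a 2-step nilpotent algebra every `ad x` squares to zero, so its Jordan blocks have length at
most 2 and the number of blocks of length 2 is the rank of `ad x`. Vectors of the derived algebra
are central, so in dimension 8 the characteristic sequence is (2,2,1,1,1,1) exactly when the maximal
rank of `ad x` is 2 (`isSymplecticOfType_iff`).

The rank bound leaves two shapes of bracket (`span_or_free`): the derived algebra is a plane, or the
bracket is the universal one on three generators, which gives n_6^20. In the plane case write the
bracket as ω₁w₁ + ω₂w₂ with 2-forms ωᵢ, and put eᵢ = θ(wᵢ, ·). Closedness of θ reads ω₁∧e₁ + ω₂∧e₂ =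
0, and nondegeneracy makes e₁, e₂ independent. An argument as in Cartan's lemma then gives ω₁ = e₁∧a
+ e₂∧b and ω₂ = e₁∧b + e₂∧d (`IsSymplectic.exists_pencilForm`).

Decomposability is now a count. The bracket depends on at most 5 functionals and the derived algebra
has dimension 2 (3 and 3 in the universal case). Since 5 + 2 < 8, some central vector lies outside
the derived algebra, and it splits off.

For the classification, a change of basis of the plane acts by congruence on the symmetric matrix
with entries a, b, b, d. If e₁, e₂, a, b, d are independent, the algebra is n_7^124 ⊕ K. Otherwise
completing the square brings the relation to d = μa (`PencilForm.exists_diagonal`). If then e₁, e₂,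
a, b are dependent, the two forms share a factor after a change of basis, which gives n_5^5. If they
are independent, μ = 0 gives n_6^19, μ = k² ≠ 0 gives n_3^1 ⊕ n_3^1, and μ = -k² ≠ 0 gives
n_6^{20,1}. Only this last step depends on the field. Conversely, explicit symplectic forms are
given on all the models. -/

theorem exists_linearIndependent_sumElim {ι : Type*} [Fintype ι] {g : ι → V}
    (hg : LinearIndependent K g) {j : ℕ} (h : finrank K V = Fintype.card ι + j) :
    ∃ χ : Fin j → V, LinearIndependent K (Sum.elim g χ) := by
  obtain ⟨Q, hQ⟩ := Submodule.exists_isCompl (Submodule.span K (Set.range g))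
  have h1 := Submodule.finrank_add_eq_of_isCompl hQ
  rw [finrank_span_eq_card hg] at h1
  let c := finBasisOfFinrankEq K Q (n := j) (by omega)
  refine ⟨fun i => (c i : V), hg.sum_type ?_ ?_⟩
  · exact c.linearIndependent.map' Q.subtype (Submodule.ker_subtype Q)
  · refine hQ.disjoint.mono_right ?_
    rw [Submodule.span_le]
    rintro _ ⟨i, rfl⟩
    exact (c i).2

theorem span_range_eq_top_of_card {ι : Type*} [Fintype ι] {g : ι → V}
    (hg : LinearIndependent K g) (h : finrank K V = Fintype.card ι) :
    Submodule.span K (Set.range g) = ⊤ := by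
  apply Submodule.eq_top_of_finrank_eq
  rw [finrank_span_eq_card hg, h]

theorem exists_dual_family {ι : Type*} [Fintype ι] [DecidableEq ι] {w : ι → V}
    (hw : LinearIndependent K w) :
    ∃ ω : ι → Dual K V, ∀ i j, ω i (w j) = if i = j then 1 else 0 := by
  have hc := hw.fintype_card_le_finrank
  obtain ⟨χ, hχ⟩ := exists_linearIndependent_sumElim hw
    (j := finrank K V - Fintype.card ι) (by omega)
  let b : Basis _ K V := Basis.mk hχ (span_range_eq_top_of_card hχ (by simp; omega)).ge
  refine ⟨fun i => b.coord (Sum.inl i), fun i j => ?_⟩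
  have : w j = b (Sum.inl j) := by simp [b]
  rw [this, Basis.coord_apply, Basis.repr_self, Finsupp.single_apply]
  simp [eq_comm]

theorem exists_span_sumElim_eq {k j : ℕ} {g : Fin k → V} (hg : LinearIndependent K g)
    (U : Submodule K V) (hU : finrank K U = k + j) (hgU : ∀ i, g i ∈ U) :
    ∃ χ : Fin j → V, (∀ i, χ i ∈ U) ∧ Submodule.span K (Set.range (Sum.elim g χ)) = U := by
  have hg' : LinearIndependent K (fun i => (⟨g i, hgU i⟩ : U)) :=
    LinearIndependent.of_comp U.subtype hg
  obtain ⟨χ, hχ⟩ := exists_linearIndependent_sumElim hg' (j := j) (by simpa using hU)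
  refine ⟨fun i => χ i, fun i => (χ i).2, ?_⟩
  have h1 := span_range_eq_top_of_card hχ (by simpa using hU)
  have h2 := congrArg (Submodule.map U.subtype) h1
  rw [Submodule.map_span, Submodule.map_top, Submodule.range_subtype, ← Set.range_comp] at h2
  convert h2 using 3
  ext i
  cases i <;> rfl

/-- Complete independent functionals that vanish on an independent family `w` to a separating
family of functionals adapted to `w`. -/
theorem exists_adapted_functionals {k m j : ℕ} {g : Fin k → Dual K V} {w : Fin m → V}
    (hg : LinearIndependent K g) (hw : LinearIndependent K w) (hgw : ∀ i l, g i (w l) = 0)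
    (hV : finrank K V = k + m + j) :
    ∃ (χ : Fin j → Dual K V) (ω : Fin m → Dual K V), (∀ i l, χ i (w l) = 0) ∧
      (∀ i l, ω i (w l) = if i = l then 1 else 0) ∧
      ∀ x, (∀ i, g i x = 0) → (∀ i, χ i x = 0) → (∀ i, ω i x = 0) → x = 0 := by
  obtain ⟨ω, hω⟩ := exists_dual_family hw
  have hU : finrank K (Submodule.span K (Set.range w)).dualAnnihilator = k + j := by
    have h1 := Subspace.finrank_add_finrank_dualAnnihilator_eq (Submodule.span K (Set.range w))
    rw [finrank_span_eq_card hw, Fintype.card_fin] at h1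
    omega
  have hmem : ∀ φ : Dual K V, φ ∈ (Submodule.span K (Set.range w)).dualAnnihilator ↔
      ∀ l, φ (w l) = 0 := by
    intro φ
    rw [Submodule.mem_dualAnnihilator]
    refine ⟨fun h l => h _ (Submodule.subset_span ⟨l, rfl⟩), fun h x hx => ?_⟩
    have : Submodule.span K (Set.range w) ≤ LinearMap.ker φ := by
      rw [Submodule.span_le]
      rintro _ ⟨l, rfl⟩
      exact h l
    exact this hx
  obtain ⟨χ, hχ, hs⟩ := exists_span_sumElim_eq hg _ hU (fun i => (hmem _).2 (hgw i))
  refine ⟨χ, ω, fun i l => (hmem _).1 (hχ i) l, hω, fun x h1 h2 h3 => ?_⟩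
  -- `g` and `χ` together span the annihilator of the span of `w`, so their common zeros are that
  -- span; there the `ω i` are coordinates.
  have hx : x ∈ Submodule.span K (Set.range w) := by
    rw [← Subspace.dualAnnihilator_dualCoannihilator_eq (W := Submodule.span K (Set.range w)),
      Submodule.mem_dualCoannihilator, ← hs]
    intro φ hφ
    have hle : Submodule.span K (Set.range (Sum.elim g χ)) ≤ LinearMap.ker (Dual.eval K V x) := by
      rw [Submodule.span_le]
      rintro _ ⟨i | i, rfl⟩
      · simpa using h1 i
      · simpa using h2 i
    simpa using hle hφ
  rw [Submodule.mem_span_range_iff_exists_fun] at hx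
  obtain ⟨c, rfl⟩ := hx
  have hc : ∀ i, c i = 0 := by
    intro i
    simpa [hω] using h3 i
  simp [hc]

/-- A square-zero endomorphism has a basis adapted to its image and kernel. -/
theorem exists_basis_of_sq_zero (f : V →ₗ[K] V) (hf : ∀ x, f (f x) = 0) {r m : ℕ}
    (hr : finrank K (LinearMap.range f) = r) (h : finrank K V = r + m + r) :
    ∃ b : Basis ((Fin r ⊕ Fin m) ⊕ Fin r) K V,
      (∀ i, f (b (Sum.inl i)) = 0) ∧ ∀ i, f (b (Sum.inr i)) = b (Sum.inl (Sum.inl i)) := by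
  obtain ⟨c⟩ : Nonempty (Basis (Fin r) K (LinearMap.range f)) := ⟨finBasisOfFinrankEq K _ hr⟩
  have hker : finrank K (LinearMap.ker f) = Fintype.card (Fin r) + m := by
    have := LinearMap.finrank_range_add_finrank_ker f
    simp only [Fintype.card_fin]
    omega
  have hmem : ∀ i, (c i : V) ∈ LinearMap.ker f := by
    intro i
    obtain ⟨y, hy⟩ := (c i).2
    rw [LinearMap.mem_ker, ← hy, hf]
  have hc : LinearIndependent K (fun i => (c i : V)) :=
    c.linearIndependent.map' _ (Submodule.ker_subtype _)
  have hc' : LinearIndependent K (fun i => (⟨c i, hmem i⟩ : LinearMap.ker f)) :=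
    LinearIndependent.of_comp (LinearMap.ker f).subtype hc
  obtain ⟨χ, hχ⟩ := exists_linearIndependent_sumElim hc' hker
  choose u hu using fun i => (c i).2
  -- Preimages of a basis of the range are independent modulo the kernel, hence complete a basis of
  -- the kernel to one of the whole space.
  have hq : LinearIndependent K
      ((Submodule.Quotient.mk (p := LinearMap.ker f)) ∘ u) := by
    refine LinearIndependent.of_comp ((LinearMap.ker f).liftQ f le_rfl) ?_
    convert hc using 1
    ext i
    simpa using hu i
  have hall := hχ.sumElim_of_quotient u hq
  refine ⟨Basis.mk hall (span_range_eq_top_of_card hall (by simp; omega)).ge, ?_, ?_⟩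
  · intro i
    rw [Basis.mk_apply]
    exact (Sum.elim (fun i => (⟨c i, hmem i⟩ : LinearMap.ker f)) χ i).2
  · intro i
    rw [Basis.mk_apply, Basis.mk_apply]
    simpa using hu i

end LinearAlgebra

end SympLie

namespace SympLie

/-! ### Jordan sequences of square-zero endomorphisms -/

section Jordan

open Module

variable {K V : Type*} [Field K] [AddCommGroup V] [Module K V]

theorem IsJordanSequence.sum_eq {f : V →ₗ[K] V} {s : List ℕ} (h : IsJordanSequence f s) :
    s.sum = finrank K V := by
  obtain ⟨-, -, b, -⟩ := h
  rw [finrank_eq_card_basis b, Fintype.card_sigma]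
  simp only [Fintype.card_fin]
  conv_lhs => rw [← List.ofFn_get s, List.sum_ofFn]

theorem IsJordanSequence.le_two {f : V →ₗ[K] V} {s : List ℕ} (h : IsJordanSequence f s)
    (hf : ∀ x, f (f x) = 0) : ∀ m ∈ s, m ≤ 2 := by
  obtain ⟨-, -, b, hb⟩ := h
  intro m hm
  obtain ⟨i, rfl⟩ := List.get_of_mem hm
  by_contra! h3
  have h1 := (hb i 1 (by omega)).2 h3
  have h0 := (hb i 0 (by omega)).2 (by omega)
  have := hf (b ⟨i, ⟨1 + 1, h3⟩⟩)
  rw [h1] at this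
  exact b.ne_zero _ (h0.symm.trans this)

/-- The bottom vectors of distinct blocks of length at least 2 lie in the range and are independent.
-/
theorem IsJordanSequence.card_le {f : V →ₗ[K] V} [FiniteDimensional K V] {s : List ℕ}
    (h : IsJordanSequence f s) {n : ℕ} (i : Fin n → Fin s.length) (hi : Function.Injective i)
    (h2 : ∀ k, 1 < s.get (i k)) : n ≤ finrank K (LinearMap.range f) := by
  obtain ⟨-, -, b, hb⟩ := h
  have hmem : ∀ k, b ⟨i k, ⟨0, (h2 k).trans' zero_lt_one⟩⟩ ∈ LinearMap.range f :=
    fun k => ⟨_, (hb (i k) 0 _).2 (h2 k)⟩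
  have hli : LinearIndependent K
      (fun k => (⟨b ⟨i k, ⟨0, (h2 k).trans' zero_lt_one⟩⟩, hmem k⟩ : LinearMap.range f)) := by
    refine LinearIndependent.of_comp (LinearMap.range f).subtype ?_
    refine b.linearIndependent.comp (fun k => ⟨i k, ⟨0, (h2 k).trans' zero_lt_one⟩⟩) ?_
    intro k l hkl
    exact hi (congrArg Sigma.fst hkl)
  simpa using hli.fintype_card_le_finrank

/-- A Jordan sequence of a square-zero map consists of 2s followed by 1s, and the rank allows at
most two 2s. With sum 8 only three lists remain. -/
theorem IsJordanSequence.le_of_finrank_range_le {f : V →ₗ[K] V} [FiniteDimensional K V]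
    {s : List ℕ} (h : IsJordanSequence f s) (hf : ∀ x, f (f x) = 0) (hV : finrank K V = 8)
    (hr : finrank K (LinearMap.range f) ≤ 2) : s ≤ [2, 2, 1, 1, 1, 1] := by
  have hsum := h.sum_eq
  rw [hV] at hsum
  have hle := h.le_two hf
  have hpos := h.2.1
  have hsort := h.1
  have ones : ∀ l : List ℕ, (∀ m ∈ l, m ≤ 1) → (∀ m ∈ l, 0 < m) → l = List.replicate l.sum 1 := by
    intro l h1 h2
    have h3 : l = List.replicate l.length 1 :=
      List.eq_replicate_of_mem fun m hm => le_antisymm (h1 m hm) (h2 m hm)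
    have h4 : l.sum = l.length := by
      conv_lhs => rw [h3]
      simp
    rwa [h4]
  have h3 : ∀ a b c t, s = a :: b :: c :: t → c ≤ 1 := by
    rintro a b c t rfl
    by_contra! hc
    simp only [List.pairwise_cons, List.mem_cons, forall_eq_or_imp] at hsort
    have := h.card_le (n := 3) ![⟨0, by simp⟩, ⟨1, by simp⟩, ⟨2, by simp⟩]
      (by intro i j; fin_cases i <;> fin_cases j <;> simp)
      (by
        intro k
        fin_cases k
        · simp; omega
        · simp; omega
        · simpa using hc)
    omega
  match s, hsum, hle, hpos, hsort, h3 with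
  | [], hsum, _, _, _, _ => simp at hsum
  | a :: t, hsum, hle, hpos, hsort, h3 =>
    simp only [List.pairwise_cons] at hsort
    simp only [List.mem_cons, forall_eq_or_imp] at hle hpos
    rw [List.sum_cons] at hsum
    by_cases ha : a ≤ 1
    · have ht := ones t (fun m hm => (hsort.1 m hm).trans ha) hpos.2
      rw [show t.sum = 7 by omega] at ht
      rw [ht, show a = 1 by omega]
      decide
    · obtain rfl : a = 2 := by omega
      match t, hsum, hle, hpos, hsort, h3 with
      | [], hsum, _, _, _, _ => simp at hsum
      | b :: t, hsum, hle, hpos, hsort, h3 =>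
        simp only [List.pairwise_cons] at hsort
        simp only [List.mem_cons, forall_eq_or_imp] at hle hpos
        rw [List.sum_cons] at hsum
        have key : ∀ m ∈ t, m ≤ 1 := by
          by_cases hb : b ≤ 1
          · exact fun m hm => (hsort.2.1 m hm).trans hb
          · match t, hsort, h3 with
            | [], _, _ => simp
            | c :: t, hsort, h3 =>
              have hc := h3 2 b c t rfl
              simp only [List.pairwise_cons] at hsort
              simp only [List.mem_cons, forall_eq_or_imp]
              exact ⟨hc, fun m hm => (hsort.2.2.1 m hm).trans hc⟩
        have ht := ones t key hpos.2.2
        have hb : b = 1 ∨ b = 2 := by omega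
        rcases hb with rfl | rfl
        · rw [show t.sum = 5 by omega] at ht
          rw [ht]
          decide
        · rw [show t.sum = 4 by omega] at ht
          rw [ht]
          decide

/-- A basis adapted to a square-zero endomorphism gives a Jordan sequence. -/
theorem isJordanSequence_of_basis {f : V →ₗ[K] V} {r m : ℕ}
    (b : Basis ((Fin r ⊕ Fin m) ⊕ Fin r) K V) (h0 : ∀ i, f (b (Sum.inl i)) = 0)
    (h1 : ∀ i, f (b (Sum.inr i)) = b (Sum.inl (Sum.inl i))) {s : List ℕ}
    (hs : s.Pairwise (· ≥ ·)) (hpos : ∀ m ∈ s, 0 < m)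
    (e : (Fin r ⊕ Fin m) ⊕ Fin r → Σ i : Fin s.length, Fin (s.get i))
    (he : Function.Bijective e)
    (e0 : ∀ i : Fin s.length, ∀ j : Fin (s.get i), j.val = 0 → ∃ k, e (Sum.inl k) = ⟨i, j⟩)
    (e1 : ∀ i : Fin s.length, ∀ j : Fin (s.get i), ∀ h : j.val + 1 < s.get i,
      ∃ k, e (Sum.inl (Sum.inl k)) = ⟨i, j⟩ ∧ e (Sum.inr k) = ⟨i, ⟨j.val + 1, h⟩⟩) :
    IsJordanSequence f s := by
  refine ⟨hs, hpos, b.reindex (Equiv.ofBijective e he), fun i j hj => ⟨fun hj0 => ?_, fun h => ?_⟩⟩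
  · obtain ⟨k, hk⟩ := e0 i ⟨j, hj⟩ hj0
    rw [Basis.reindex_apply, ← hk, Equiv.ofBijective_symm_apply_apply, h0]
  · obtain ⟨k, hk, hk'⟩ := e1 i ⟨j, hj⟩ h
    rw [Basis.reindex_apply, Basis.reindex_apply, ← hk, ← hk', Equiv.ofBijective_symm_apply_apply,
      Equiv.ofBijective_symm_apply_apply, h1]

variable [FiniteDimensional K V]

theorem isJordanSequence_two {f : V →ₗ[K] V} (hf : ∀ x, f (f x) = 0) (hV : finrank K V = 8)
    (hr : finrank K (LinearMap.range f) = 2) : IsJordanSequence f [2, 2, 1, 1, 1, 1] := by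
  obtain ⟨b, h0, h1⟩ := exists_basis_of_sq_zero f hf (m := 4) hr hV
  exact isJordanSequence_of_basis b h0 h1 (by decide) (by decide)
    (Sum.elim (Sum.elim ![⟨0, ⟨0, by decide⟩⟩, ⟨1, ⟨0, by decide⟩⟩]
      ![⟨2, ⟨0, by decide⟩⟩, ⟨3, ⟨0, by decide⟩⟩, ⟨4, ⟨0, by decide⟩⟩, ⟨5, ⟨0, by decide⟩⟩])
      ![⟨0, ⟨1, by decide⟩⟩, ⟨1, ⟨1, by decide⟩⟩])
    (by decide) (by decide) (by decide)

theorem isJordanSequence_three {f : V →ₗ[K] V} (hf : ∀ x, f (f x) = 0) (hV : finrank K V = 8)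
    (hr : finrank K (LinearMap.range f) = 3) : IsJordanSequence f [2, 2, 2, 1, 1] := by
  obtain ⟨b, h0, h1⟩ := exists_basis_of_sq_zero f hf (m := 2) hr hV
  exact isJordanSequence_of_basis b h0 h1 (by decide) (by decide)
    (Sum.elim (Sum.elim ![⟨0, ⟨0, by decide⟩⟩, ⟨1, ⟨0, by decide⟩⟩, ⟨2, ⟨0, by decide⟩⟩]
      ![⟨3, ⟨0, by decide⟩⟩, ⟨4, ⟨0, by decide⟩⟩])
      ![⟨0, ⟨1, by decide⟩⟩, ⟨1, ⟨1, by decide⟩⟩, ⟨2, ⟨1, by decide⟩⟩])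
    (by decide) (by decide) (by decide)

theorem isJordanSequence_four {f : V →ₗ[K] V} (hf : ∀ x, f (f x) = 0) (hV : finrank K V = 8)
    (hr : finrank K (LinearMap.range f) = 4) : IsJordanSequence f [2, 2, 2, 2] := by
  obtain ⟨b, h0, h1⟩ := exists_basis_of_sq_zero f hf (m := 0) hr hV
  exact isJordanSequence_of_basis b h0 h1 (by decide) (by decide)
    (Sum.elim (Sum.elim ![⟨0, ⟨0, by decide⟩⟩, ⟨1, ⟨0, by decide⟩⟩, ⟨2, ⟨0, by decide⟩⟩,
      ⟨3, ⟨0, by decide⟩⟩] ![])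
      ![⟨0, ⟨1, by decide⟩⟩, ⟨1, ⟨1, by decide⟩⟩, ⟨2, ⟨1, by decide⟩⟩, ⟨3, ⟨1, by decide⟩⟩])
    (by decide) (by decide) (by decide)

theorem finrank_range_le_of_sq_zero {f : V →ₗ[K] V} (hf : ∀ x, f (f x) = 0) :
    2 * finrank K (LinearMap.range f) ≤ finrank K V := by
  have h1 := LinearMap.finrank_range_add_finrank_ker f
  have h2 : LinearMap.range f ≤ LinearMap.ker f := by
    rintro _ ⟨x, rfl⟩
    exact hf x
  have := Submodule.finrank_mono h2
  omega

end Jordan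

/-! ### Reformulation of the hypotheses -/

section Reformulation

open Module

variable (K : Type*) [Field K] (L : Type*) [LieRing L] [LieAlgebra K L]

theorem isTwoStepNilpotent_iff :
    IsTwoStepNilpotent K L ↔ (∀ x y z : L, ⁅x, ⁅y, z⁆⁆ = 0) ∧ ∃ x y : L, ⁅x, y⁆ ≠ 0 := by
  unfold IsTwoStepNilpotent
  have h1 : LieModule.lowerCentralSeries K L L 1 = ⁅(⊤ : LieIdeal K L), (⊤ : LieIdeal K L)⁆ := by
    rw [LieModule.lowerCentralSeries_succ, LieModule.lowerCentralSeries_zero]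
  rw [LieModule.lowerCentralSeries_succ, h1]
  refine and_congr ⟨fun h x y z => ?_, fun h => ?_⟩ (not_iff_comm.1 ?_)
  · have := LieSubmodule.lie_mem_lie (LieSubmodule.mem_top (R := K) (L := L) x)
      (LieSubmodule.lie_mem_lie (LieSubmodule.mem_top (R := K) (L := L) y)
        (LieSubmodule.mem_top (R := K) (L := L) z))
    rw [h] at this
    simpa using this
  · have hc : ⁅(⊤ : LieIdeal K L), (⊤ : LieIdeal K L)⁆ ≤ LieModule.maxTrivSubmodule K L L := by
      rw [LieSubmodule.lie_le_iff]
      intro x _ m _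
      rw [LieModule.mem_maxTrivSubmodule]
      exact fun y => h y x m
    rw [← le_bot_iff, LieSubmodule.lie_le_iff]
    intro x _ m hm
    rw [LieSubmodule.mem_bot]
    exact (LieModule.mem_maxTrivSubmodule K L L m).1 (hc hm) x
  · push Not
    rw [← le_bot_iff, LieSubmodule.lie_le_iff]
    simp

variable {K L} in
theorem lie_eq_zero_of_mem_lowerCentralSeries (h : ∀ x y z : L, ⁅x, ⁅y, z⁆⁆ = 0) {m : L}
    (hm : m ∈ LieModule.lowerCentralSeries K L L 1) (x : L) : ⁅m, x⁆ = 0 := by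
  have hc : LieModule.lowerCentralSeries K L L 1 ≤ LieModule.maxTrivSubmodule K L L := by
    rw [LieModule.lowerCentralSeries_succ, LieModule.lowerCentralSeries_zero,
      LieSubmodule.lie_le_iff]
    intro x _ m _
    rw [LieModule.mem_maxTrivSubmodule]
    exact fun y => h y x m
  rw [← lie_skew, (LieModule.mem_maxTrivSubmodule K L L m).1 (hc hm) x, neg_zero]

/-- `8`-dimensional symplectic Lie algebras with vanishing double brackets, whose adjoint maps have
maximal rank `2`. -/
structure IsSymplecticOfRankTwo : Prop where
  finrank_eq : finrank K L = 8
  lie_lie (x y z : L) : ⁅x, ⁅y, z⁆⁆ = 0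
  symplectic : IsSymplectic K L
  rank_le (x : L) : finrank K (LinearMap.range (LieAlgebra.ad K L x)) ≤ 2
  rank_eq : ∃ x : L, finrank K (LinearMap.range (LieAlgebra.ad K L x)) = 2

end Reformulation

end SympLie

namespace SympLie

/-! ### The characteristic sequence as a rank condition; criteria for rank two and for
symplecticity. -/

section Equivalence

open Module

variable {K : Type*} [Field K] {L : Type*} [LieRing L] [LieAlgebra K L]

theorem ad_ad_self (h : ∀ x y z : L, ⁅x, ⁅y, z⁆⁆ = 0) (x y : L) :
    LieAlgebra.ad K L x (LieAlgebra.ad K L x y) = 0 := by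
  simpa using h x x y

/-- A square-zero map in dimension 8 has rank at most 4, and ranks 3 and 4 would give the
lexicographically larger sequences (2,2,2,1,1) and (2,2,2,2). Leaving out the derived algebra does
no harm, since `ad` vanishes on it. -/
theorem isSymplecticOfType_iff :
    IsSymplecticOfType221111 K L ↔ IsSymplecticOfRankTwo K L := by
  constructor
  · rintro ⟨h8, h2, hs, ⟨x, hx, hJ⟩, hub⟩
    have : FiniteDimensional K L := FiniteDimensional.of_finrank_pos (by omega)
    have hnil := ((isTwoStepNilpotent_iff K L).1 h2).1
    have hle : ∀ y : L, finrank K (LinearMap.range (LieAlgebra.ad K L y)) ≤ 2 := by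
      intro y
      by_contra! hy
      have hsq := ad_ad_self (K := K) hnil y
      have hyc : y ∉ LieModule.lowerCentralSeries K L L 1 := by
        intro hmem
        have h0 : LieAlgebra.ad K L y = 0 := by
          ext z
          simpa using lie_eq_zero_of_mem_lowerCentralSeries hnil hmem z
        rw [h0, LinearMap.range_zero, finrank_bot] at hy
        omega
      have h4 := finrank_range_le_of_sq_zero hsq
      have h34 : finrank K (LinearMap.range (LieAlgebra.ad K L y)) = 3 ∨
          finrank K (LinearMap.range (LieAlgebra.ad K L y)) = 4 := by omega
      rcases h34 with h | h
      · exact absurd (hub ⟨y, hyc, isJordanSequence_three hsq h8 h⟩) (by decide)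
      · exact absurd (hub ⟨y, hyc, isJordanSequence_four hsq h8 h⟩) (by decide)
    refine ⟨h8, hnil, hs, hle, x, le_antisymm (hle x) ?_⟩
    exact hJ.card_le ![⟨0, by decide⟩, ⟨1, by decide⟩] (by decide) (by decide)
  · rintro ⟨h8, hnil, hs, hle, x, hx⟩
    have : FiniteDimensional K L := FiniteDimensional.of_finrank_pos (by omega)
    have hx0 : LieAlgebra.ad K L x ≠ 0 := by
      intro h0
      rw [h0, LinearMap.range_zero, finrank_bot] at hx
      omega
    refine ⟨h8, (isTwoStepNilpotent_iff K L).2 ⟨hnil, ?_⟩, hs, ⟨x, ?_, ?_⟩, ?_⟩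
    · by_contra! h
      exact hx0 (LinearMap.ext fun z => by simpa using h x z)
    · intro hmem
      exact hx0 (LinearMap.ext fun z => by
        simpa using lie_eq_zero_of_mem_lowerCentralSeries hnil hmem z)
    · exact isJordanSequence_two (ad_ad_self hnil x) h8 hx
    · rintro t ⟨y, -, hy⟩
      exact hy.le_of_finrank_range_le (ad_ad_self hnil y) h8 (hle y)

theorem finrank_range_ad_equiv {M : Type*} [LieRing M] [LieAlgebra K M] (e : L ≃ₗ⁅K⁆ M) (x : L) :
    finrank K (LinearMap.range (LieAlgebra.ad K M (e x))) =
      finrank K (LinearMap.range (LieAlgebra.ad K L x)) := by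
  have : LinearMap.range (LieAlgebra.ad K M (e x)) =
      (LinearMap.range (LieAlgebra.ad K L x)).map (e.toLinearEquiv : L →ₗ[K] M) := by
    ext z
    simp only [LinearMap.mem_range, Submodule.mem_map, LieAlgebra.ad_apply]
    constructor
    · rintro ⟨y, rfl⟩
      exact ⟨⁅x, e.symm y⁆, ⟨_, rfl⟩, by simp [LieEquiv.map_lie]⟩
    · rintro ⟨_, ⟨y, rfl⟩, rfl⟩
      exact ⟨e y, by simp [LieEquiv.map_lie]⟩
  rw [this, LinearEquiv.finrank_map_eq]

theorem IsSymplecticOfRankTwo.of_equiv {M : Type*} [LieRing M] [LieAlgebra K M]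
    (h : IsSymplecticOfRankTwo K M) (e : L ≃ₗ⁅K⁆ M) : IsSymplecticOfRankTwo K L := by
  obtain ⟨h8, hnil, ⟨θ, halt, ⟨hl, hr⟩, hcl⟩, hle, x, hx⟩ := h
  refine ⟨e.toLinearEquiv.finrank_eq.trans h8, fun x y z => ?_,
    ⟨θ.compl₁₂ (e : L →ₗ[K] M) (e : L →ₗ[K] M), fun x => ?_, ⟨fun x hx => ?_, fun x hx => ?_⟩,
      fun x y z => ?_⟩, fun x => ?_, e.symm x, ?_⟩
  · exact e.injective (by simp [hnil])
  · simpa using halt (e x)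
  · have := hl (e x) fun y => by simpa using hx (e.symm y)
    simpa using this
  · have := hr (e x) fun y => by simpa using hx (e.symm y)
    simpa using this
  · simpa [LieEquiv.map_lie] using hcl (e x) (e y) (e z)
  · rw [← finrank_range_ad_equiv e]
    exact hle _
  · rw [← finrank_range_ad_equiv e]
    rwa [e.apply_symm_apply]

/-- The form is ∑ fᵢ∧gᵢ. Eight functionals that separate the points of an 8-dimensional space are
coordinates, so these are Darboux coordinates and the form is nondegenerate. -/
theorem isSymplectic_of_functionals (f g : Fin 4 → Dual K L) (hL : finrank K L = 8)
    (hsep : ∀ x, (∀ i, f i x = 0) → (∀ i, g i x = 0) → x = 0)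
    (hcl : ∀ x y z : L, ∑ i, (f i ⁅x, y⁆ * g i z - g i ⁅x, y⁆ * f i z) +
      ∑ i, (f i ⁅y, z⁆ * g i x - g i ⁅y, z⁆ * f i x) +
      ∑ i, (f i ⁅z, x⁆ * g i y - g i ⁅z, x⁆ * f i y) = 0) : IsSymplectic K L := by
  have : FiniteDimensional K L := FiniteDimensional.of_finrank_pos (by omega)
  let θ : LinearMap.BilinForm K L := ∑ i, (LinearMap.BilinForm.linMulLin (f i) (g i) -
    LinearMap.BilinForm.linMulLin (g i) (f i))
  have hθ : ∀ x y, θ x y = ∑ i, (f i x * g i y - g i x * f i y) := by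
    intro x y
    simp [θ, LinearMap.sum_apply]
  have halt : θ.IsAlt := by
    intro x
    rw [hθ]
    exact Finset.sum_eq_zero fun i _ => by ring
  let Φ : L →ₗ[K] (Fin 4 → K) × (Fin 4 → K) := (LinearMap.pi f).prod (LinearMap.pi g)
  have hΦ : Function.Injective Φ := by
    rw [← LinearMap.ker_eq_bot, LinearMap.ker_eq_bot']
    intro x hx
    have h1 := congrArg Prod.fst hx
    have h2 := congrArg Prod.snd hx
    exact hsep x (fun i => congrFun h1 i) (fun i => congrFun h2 i)
  have hsurj : Function.Surjective Φ :=
    (LinearMap.injective_iff_surjective_of_finrank_eq_finrank (by simp [hL])).1 hΦ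
  have hl : θ.SeparatingLeft := by
    intro x hx
    refine hsep x (fun i => ?_) (fun i => ?_)
    · obtain ⟨y, hy⟩ := hsurj (0, Pi.single i 1)
      have h1 : ∀ j, f j y = 0 := fun j => congrFun (congrArg Prod.fst hy) j
      have h2 : ∀ j, g j y = Pi.single (M := fun _ => K) i 1 j :=
        fun j => congrFun (congrArg Prod.snd hy) j
      have := hx y
      rw [hθ] at this
      simpa [h1, h2, Pi.single_apply] using this
    · obtain ⟨y, hy⟩ := hsurj (Pi.single i 1, 0)
      have h1 : ∀ j, f j y = Pi.single (M := fun _ => K) i 1 j :=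
        fun j => congrFun (congrArg Prod.fst hy) j
      have h2 : ∀ j, g j y = 0 := fun j => congrFun (congrArg Prod.snd hy) j
      have := hx y
      rw [hθ] at this
      simpa [h1, h2, Pi.single_apply] using this
  refine ⟨θ, halt, ⟨hl, fun y hy => hl y fun x => ?_⟩, fun x y z => ?_⟩
  · rw [← neg_eq_zero, LinearMap.IsAlt.neg halt, hy]
  · simpa only [hθ] using hcl x y z

theorem finrank_range_le_of_functionals {V : Type*} [AddCommGroup V] [Module K V]
    (f : V →ₗ[K] V) {n : ℕ} (φ : Fin n → Dual K V) (h : ∀ x, (∀ i, φ i (f x) = 0) → f x = 0) :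
    finrank K (LinearMap.range f) ≤ n := by
  have := LinearMap.finrank_le_finrank_of_injective
    (f := (LinearMap.pi φ).comp (LinearMap.range f).subtype) (by
      rw [← LinearMap.ker_eq_bot, LinearMap.ker_eq_bot']
      rintro ⟨_, x, rfl⟩ hx
      exact Subtype.ext (h x fun i => congrFun hx i))
  simpa using this

theorem two_le_finrank_range {V : Type*} [AddCommGroup V] [Module K V] [FiniteDimensional K V]
    (f : V →ₗ[K] V) {u v : V} (h : LinearIndependent K ![f u, f v]) :
    2 ≤ finrank K (LinearMap.range f) := by
  have h1 : LinearIndependent K ![f.rangeRestrict u, f.rangeRestrict v] := by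
    refine LinearIndependent.of_comp (LinearMap.range f).subtype ?_
    convert h using 1
    ext i
    fin_cases i <;> rfl
  simpa using h1.fintype_card_le_finrank

/-- In `hle` the functionals may depend on `x`: for n_6^20 the derived algebra has dimension 3
although each `ad x` has rank at most 2. -/
theorem IsSymplecticOfRankTwo.mk_of_functionals (f g : Fin 4 → Dual K L) (hL : finrank K L = 8)
    (hnil : ∀ x y z : L, ⁅x, ⁅y, z⁆⁆ = 0)
    (hsep : ∀ x, (∀ i, f i x = 0) → (∀ i, g i x = 0) → x = 0)
    (hcl : ∀ x y z : L, ∑ i, (f i ⁅x, y⁆ * g i z - g i ⁅x, y⁆ * f i z) +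
      ∑ i, (f i ⁅y, z⁆ * g i x - g i ⁅y, z⁆ * f i x) +
      ∑ i, (f i ⁅z, x⁆ * g i y - g i ⁅z, x⁆ * f i y) = 0)
    (hle : ∀ x : L, ∃ φ : Fin 2 → Dual K L, ∀ y, (∀ i, φ i ⁅x, y⁆ = 0) → ⁅x, y⁆ = 0)
    {φ ψ : Dual K L} {x u v : L} (h1 : φ ⁅x, u⁆ = 1) (h2 : φ ⁅x, v⁆ = 0) (h3 : ψ ⁅x, u⁆ = 0)
    (h4 : ψ ⁅x, v⁆ = 1) : IsSymplecticOfRankTwo K L := by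
  have : FiniteDimensional K L := FiniteDimensional.of_finrank_pos (by omega)
  have hle' : ∀ x : L, finrank K (LinearMap.range (LieAlgebra.ad K L x)) ≤ 2 := by
    intro x
    obtain ⟨φ, hφ⟩ := hle x
    exact finrank_range_le_of_functionals _ φ hφ
  refine ⟨hL, hnil, isSymplectic_of_functionals f g hL hsep hcl, hle', x,
    le_antisymm (hle' x) (two_le_finrank_range _ (u := u) (v := v) ?_)⟩
  rw [LinearIndependent.pair_iff]
  intro s t hst
  rw [LieAlgebra.ad_apply, LieAlgebra.ad_apply] at hst
  have e1 := congrArg φ hst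
  have e2 := congrArg ψ hst
  simp only [map_add, map_smul, h1, h2, h3, h4, map_zero, smul_eq_mul] at e1 e2
  exact ⟨by simpa using e1, by simpa using e2⟩

end Equivalence

end SympLie

namespace SympLie

/-! ### The Lie algebras of the list are symplectic of the right type -/

section ModelProperties

open Module

namespace BracketTable

variable {K : Type*} [Field K] {n : ℕ} (D : BracketTable K n)

/-- The coordinate functionals of the Lie algebra of a bracket table. -/
def coord (i : Fin n) : Dual K D.Alg := LinearMap.proj (R := K) (φ := fun _ : Fin n => K) i

/-- The coordinate basis vectors of the Lie algebra of a bracket table. -/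
def vec (i : Fin n) : D.Alg := Pi.single (M := fun _ : Fin n => K) i 1

theorem coord_lie (i : Fin n) (x y : D.Alg) :
    D.coord i ⁅x, y⁆ = D.br (fun j => D.coord j x) (fun j => D.coord j y) i := rfl

theorem coord_vec (i j : Fin n) : D.coord i (D.vec j) = if i = j then 1 else 0 :=
  by
  rw [coord, vec]
  exact Pi.single_apply j 1 i

theorem ext_coord {x y : D.Alg} (h : ∀ i, D.coord i x = D.coord i y) : x = y := funext h

theorem lie_lie (x y z : D.Alg) : ⁅x, ⁅y, z⁆⁆ = 0 := D.nil x y z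

theorem finrank_alg : finrank K D.Alg = n := finrank_fin_fun K

instance : FiniteDimensional K D.Alg := inferInstanceAs (FiniteDimensional K (Fin n → K))

end BracketTable

variable (K : Type*) [Field K]

theorem abelianTable_br (m : ℕ) (x y : Fin m → K) : (abelianTable K m).br x y = 0 := rfl

theorem n3_1Table_br (x y : Fin 3 → K) :
    (n3_1Table K).br x y = ![0, 0, x 0 * y 1 - x 1 * y 0] := rfl

theorem n5_5Table_br (x y : Fin 5 → K) : (n5_5Table K).br x y =
    ![0, 0, x 0 * y 1 - x 1 * y 0, 0, x 0 * y 3 - x 3 * y 0] := rfl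

theorem n6_19Table_br (x y : Fin 6 → K) : (n6_19Table K).br x y =
    ![0, 0, x 0 * y 1 - x 1 * y 0, 0,
      (x 0 * y 3 - x 3 * y 0) + (x 1 * y 5 - x 5 * y 1), 0] := rfl

theorem n6_20Table_br (x y : Fin 6 → K) : (n6_20Table K).br x y =
    ![0, 0, x 0 * y 1 - x 1 * y 0, 0, x 0 * y 3 - x 3 * y 0, x 1 * y 3 - x 3 * y 1] := rfl

theorem n6_20_1Table_br (x y : Fin 6 → K) : (n6_20_1Table K).br x y =
    ![0, 0, (x 0 * y 1 - x 1 * y 0) + (x 3 * y 5 - x 5 * y 3), 0,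
      (x 0 * y 3 - x 3 * y 0) - (x 1 * y 5 - x 5 * y 1), 0] := rfl

theorem n7_124Table_br (x y : Fin 7 → K) : (n7_124Table K).br x y =
    ![0, 0, (x 0 * y 1 - x 1 * y 0) + (x 3 * y 6 - x 6 * y 3), 0,
      (x 0 * y 3 - x 3 * y 0) + (x 5 * y 6 - x 6 * y 5), 0, 0] := rfl

open BracketTable in
theorem isSymplecticOfRankTwo_n7_124 : IsSymplecticOfRankTwo K (N7_124 K × Ab K 1) := by
  let c (i : Fin 7) : Dual K (N7_124 K × Ab K 1) := (coord _ i).comp (LinearMap.fst K _ _)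
  let d (i : Fin 1) : Dual K (N7_124 K × Ab K 1) := (coord _ i).comp (LinearMap.snd K _ _)
  -- The pencil form with w₁ = X₃, w₂ = X₅ has e₁ = `c 0` and e₂ = `-c 6`, which dictates the
  -- partners of `c 2` and `c 4`. The other coordinates vanish on brackets, so any pairing of them
  -- is closed.
  refine IsSymplecticOfRankTwo.mk_of_functionals (φ := c 2) (ψ := c 4) (x := (vec _ 0, 0))
    (u := (vec _ 1, 0)) (v := (vec _ 3, 0))
    ![c 2, -c 4, c 1, c 5] ![c 0, c 6, c 3, d 0] ?_ ?_ ?_ ?_ ?_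
    ?_ ?_ ?_ ?_
  · simp [finrank_alg]
  · intro x y z
    exact Prod.ext (lie_lie _ _ _ _) (lie_lie _ _ _ _)
  · intro x h1 h2
    simp [Fin.forall_fin_succ, c, d] at h1 h2
    refine Prod.ext (ext_coord _ fun i => ?_) (ext_coord _ fun i => ?_)
    · fin_cases i <;> simp [*]
    · fin_cases i; simp [*]
  · intro x y z
    simp [Fin.sum_univ_four, c, d, coord_lie, n7_124Table_br, abelianTable_br]
    ring
  · refine fun x => ⟨![c 2, c 4], fun y h => ?_⟩
    simp [Fin.forall_fin_succ, c] at h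
    refine Prod.ext (ext_coord _ fun i => ?_) (ext_coord _ fun i => ?_)
    · fin_cases i <;> simp [coord_lie, n7_124Table_br] at h ⊢ <;> simp [*]
    · simp [coord_lie, abelianTable_br]
  all_goals simp [c, coord_lie, n7_124Table_br, coord_vec]

open BracketTable in
theorem isSymplecticOfRankTwo_n6_19 : IsSymplecticOfRankTwo K (N6_19 K × Ab K 2) := by
  let c (i : Fin 6) : Dual K (N6_19 K × Ab K 2) := (coord _ i).comp (LinearMap.fst K _ _)
  let d (i : Fin 2) : Dual K (N6_19 K × Ab K 2) := (coord _ i).comp (LinearMap.snd K _ _)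
  refine IsSymplecticOfRankTwo.mk_of_functionals (φ := c 2) (ψ := c 4) (x := (vec _ 0, 0))
    (u := (vec _ 1, 0)) (v := (vec _ 3, 0))
    ![c 4, -c 2, c 1, d 0] ![c 0, c 5, c 3, d 1] ?_ ?_ ?_ ?_ ?_
    ?_ ?_ ?_ ?_
  · simp [finrank_alg]
  · intro x y z
    exact Prod.ext (lie_lie _ _ _ _) (lie_lie _ _ _ _)
  · intro x h1 h2
    simp [Fin.forall_fin_succ, c, d] at h1 h2
    refine Prod.ext (ext_coord _ fun i => ?_) (ext_coord _ fun i => ?_)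
    · fin_cases i <;> simp [*]
    · fin_cases i <;> simp [*]
  · intro x y z
    simp [Fin.sum_univ_four, c, d, coord_lie, n6_19Table_br, abelianTable_br]
    ring
  · refine fun x => ⟨![c 2, c 4], fun y h => ?_⟩
    simp [Fin.forall_fin_succ, c] at h
    refine Prod.ext (ext_coord _ fun i => ?_) (ext_coord _ fun i => ?_)
    · fin_cases i <;> simp [coord_lie, n6_19Table_br] at h ⊢ <;> simp [*]
    · simp [coord_lie, abelianTable_br]
  all_goals simp [c, coord_lie, n6_19Table_br, coord_vec]

open BracketTable in
theorem isSymplecticOfRankTwo_n6_20 : IsSymplecticOfRankTwo K (N6_20 K × Ab K 2) := by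
  let c (i : Fin 6) : Dual K (N6_20 K × Ab K 2) := (coord _ i).comp (LinearMap.fst K _ _)
  let d (i : Fin 2) : Dual K (N6_20 K × Ab K 2) := (coord _ i).comp (LinearMap.snd K _ _)
  -- On brackets `c 2`, `c 4`, `c 5` are the 2-forms `c 0 ∧ c 1`, `c 0 ∧ c 3`, `c 1 ∧ c 3`; each is
  -- paired with one of its own factors, so closedness holds term by term.
  refine IsSymplecticOfRankTwo.mk_of_functionals (φ := c 2) (ψ := c 4) (x := (vec _ 0, 0))
    (u := (vec _ 1, 0)) (v := (vec _ 3, 0))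
    ![c 2, c 4, c 5, d 0] ![c 0, c 3, c 1, d 1] ?_ ?_ ?_ ?_ ?_
    ?_ ?_ ?_ ?_
  · simp [finrank_alg]
  · intro x y z
    exact Prod.ext (lie_lie _ _ _ _) (lie_lie _ _ _ _)
  · intro x h1 h2
    simp [Fin.forall_fin_succ, c, d] at h1 h2
    refine Prod.ext (ext_coord _ fun i => ?_) (ext_coord _ fun i => ?_)
    · fin_cases i <;> simp [*]
    · fin_cases i <;> simp [*]
  · intro x y z
    simp [Fin.sum_univ_four, c, d, coord_lie, n6_20Table_br, abelianTable_br]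
    ring
  · intro x
    have key : ∀ φ : Fin 2 → Dual K (N6_20 K × Ab K 2),
        (∀ y, (∀ i, φ i ⁅x, y⁆ = 0) → c 2 ⁅x, y⁆ = 0 ∧ c 4 ⁅x, y⁆ = 0 ∧ c 5 ⁅x, y⁆ = 0) →
        ∀ y, (∀ i, φ i ⁅x, y⁆ = 0) → ⁅x, y⁆ = 0 := by
      intro φ hφ y hy
      have h := hφ y hy
      simp [c] at h
      refine Prod.ext (ext_coord _ fun i => ?_) (ext_coord _ fun i => ?_)
      · fin_cases i <;> simp [coord_lie, n6_20Table_br] at h ⊢ <;> simp [*]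
      · simp [coord_lie, abelianTable_br]
    -- The three components of the bracket are the 2×2 minors of two vectors of K³. They satisfy a
    -- linear relation with the coordinates of `x` as coefficients, so two of them suffice; which
    -- two depends on `x`.
    by_cases h0 : coord (n6_20Table K) 0 x.1 = 0
    · by_cases h1 : coord (n6_20Table K) 1 x.1 = 0
      · refine ⟨![c 4, c 5], key _ fun y hy => ?_⟩
        simp [Fin.forall_fin_succ, c, coord_lie, n6_20Table_br, h0, h1] at hy ⊢
        exact hy
      · refine ⟨![c 2, c 5], key _ fun y hy => ?_⟩
        simp [Fin.forall_fin_succ, c, coord_lie, n6_20Table_br, h0, h1] at hy ⊢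
        simp [hy]
    · refine ⟨![c 2, c 4], key _ fun y hy => ?_⟩
      simp [Fin.forall_fin_succ, c, coord_lie, n6_20Table_br] at hy ⊢
      refine ⟨hy.1, hy.2, ?_⟩
      have : coord (n6_20Table K) 0 x.1 * (coord (n6_20Table K) 1 x.1 * coord _ 3 y.1 -
          coord _ 3 x.1 * coord _ 1 y.1) = 0 := by
        linear_combination coord _ 1 x.1 * hy.2 - coord _ 3 x.1 * hy.1
      exact (mul_eq_zero.1 this).resolve_left h0
  all_goals simp [c, coord_lie, n6_20Table_br, coord_vec]

open BracketTable in
theorem isSymplecticOfRankTwo_n6_20_1 : IsSymplecticOfRankTwo K (N6_20_1 K × Ab K 2) := by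
  let c (i : Fin 6) : Dual K (N6_20_1 K × Ab K 2) := (coord _ i).comp (LinearMap.fst K _ _)
  let d (i : Fin 2) : Dual K (N6_20_1 K × Ab K 2) := (coord _ i).comp (LinearMap.snd K _ _)
  refine IsSymplecticOfRankTwo.mk_of_functionals (φ := c 2) (ψ := c 4) (x := (vec _ 0, 0))
    (u := (vec _ 1, 0)) (v := (vec _ 3, 0))
    ![c 2, -c 4, c 1, d 0] ![c 0, c 5, c 3, d 1] ?_ ?_ ?_ ?_ ?_
    ?_ ?_ ?_ ?_
  · simp [finrank_alg]
  · intro x y z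
    exact Prod.ext (lie_lie _ _ _ _) (lie_lie _ _ _ _)
  · intro x h1 h2
    simp [Fin.forall_fin_succ, c, d] at h1 h2
    refine Prod.ext (ext_coord _ fun i => ?_) (ext_coord _ fun i => ?_)
    · fin_cases i <;> simp [*]
    · fin_cases i <;> simp [*]
  · intro x y z
    simp [Fin.sum_univ_four, c, d, coord_lie, n6_20_1Table_br, abelianTable_br]
    ring
  · refine fun x => ⟨![c 2, c 4], fun y h => ?_⟩
    simp [Fin.forall_fin_succ, c] at h
    refine Prod.ext (ext_coord _ fun i => ?_) (ext_coord _ fun i => ?_)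
    · fin_cases i <;> simp [coord_lie, n6_20_1Table_br] at h ⊢ <;> simp [*]
    · simp [coord_lie, abelianTable_br]
  all_goals simp [c, coord_lie, n6_20_1Table_br, coord_vec]

open BracketTable in
theorem isSymplecticOfRankTwo_n5_5 : IsSymplecticOfRankTwo K (N5_5 K × Ab K 3) := by
  let c (i : Fin 5) : Dual K (N5_5 K × Ab K 3) := (coord _ i).comp (LinearMap.fst K _ _)
  let d (i : Fin 3) : Dual K (N5_5 K × Ab K 3) := (coord _ i).comp (LinearMap.snd K _ _)
  refine IsSymplecticOfRankTwo.mk_of_functionals (φ := c 2) (ψ := c 4) (x := (vec _ 0, 0))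
    (u := (vec _ 1, 0)) (v := (vec _ 3, 0))
    ![c 2, c 4, c 1, d 1] ![c 0, c 3, d 0, d 2] ?_ ?_ ?_ ?_ ?_
    ?_ ?_ ?_ ?_
  · simp [finrank_alg]
  · intro x y z
    exact Prod.ext (lie_lie _ _ _ _) (lie_lie _ _ _ _)
  · intro x h1 h2
    simp [Fin.forall_fin_succ, c, d] at h1 h2
    refine Prod.ext (ext_coord _ fun i => ?_) (ext_coord _ fun i => ?_)
    · fin_cases i <;> simp [*]
    · fin_cases i <;> simp [*]
  · intro x y z
    simp [Fin.sum_univ_four, c, d, coord_lie, n5_5Table_br, abelianTable_br]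
    ring
  · refine fun x => ⟨![c 2, c 4], fun y h => ?_⟩
    simp [Fin.forall_fin_succ, c] at h
    refine Prod.ext (ext_coord _ fun i => ?_) (ext_coord _ fun i => ?_)
    · fin_cases i <;> simp [coord_lie, n5_5Table_br] at h ⊢ <;> simp [*]
    · simp [coord_lie, abelianTable_br]
  all_goals simp [c, coord_lie, n5_5Table_br, coord_vec]

open BracketTable in
theorem isSymplecticOfRankTwo_n3_1_n3_1 : IsSymplecticOfRankTwo K (N3_1 K × N3_1 K × Ab K 2) := by
  let c (i : Fin 3) : Dual K (N3_1 K × N3_1 K × Ab K 2) := (coord _ i).comp (LinearMap.fst K _ _)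
  let c' (i : Fin 3) : Dual K (N3_1 K × N3_1 K × Ab K 2) :=
    (coord _ i).comp ((LinearMap.fst K _ _).comp (LinearMap.snd K _ _))
  let d (i : Fin 2) : Dual K (N3_1 K × N3_1 K × Ab K 2) :=
    (coord _ i).comp ((LinearMap.snd K _ _).comp (LinearMap.snd K _ _))
  refine IsSymplecticOfRankTwo.mk_of_functionals (φ := c 2) (ψ := c' 2) (x := (vec _ 0, vec _ 0, 0))
    (u := (vec _ 1, 0, 0)) (v := (0, vec _ 1, 0))
    ![c 2, c' 2, c 1, d 0] ![c 0, c' 0, c' 1, d 1] ?_ ?_ ?_ ?_ ?_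
    ?_ ?_ ?_ ?_
  · simp [finrank_alg]
  · intro x y z
    exact Prod.ext (lie_lie _ _ _ _) (Prod.ext (lie_lie _ _ _ _) (lie_lie _ _ _ _))
  · intro x h1 h2
    simp [Fin.forall_fin_succ, c, c', d] at h1 h2
    refine Prod.ext (ext_coord _ fun i => ?_) (Prod.ext (ext_coord _ fun i => ?_)
      (ext_coord _ fun i => ?_))
    all_goals fin_cases i <;> simp [*]
  · intro x y z
    simp [Fin.sum_univ_four, c, c', d, coord_lie, n3_1Table_br, abelianTable_br]
    ring
  · refine fun x => ⟨![c 2, c' 2], fun y h => ?_⟩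
    simp [Fin.forall_fin_succ, c, c'] at h
    refine Prod.ext (ext_coord _ fun i => ?_) (Prod.ext (ext_coord _ fun i => ?_)
      (ext_coord _ fun i => ?_))
    · fin_cases i <;> simp [coord_lie, n3_1Table_br] at h ⊢; simp [*]
    · fin_cases i <;> simp [coord_lie, n3_1Table_br] at h ⊢; simp [*]
    · simp [coord_lie, abelianTable_br]
  all_goals simp [c, c', coord_lie, n3_1Table_br, coord_vec]

end ModelProperties

end SympLie

namespace SympLie

/-! ### Isomorphisms from coordinate functionals -/

section Isomorphisms

open Module

variable {K : Type*} [Field K] {L : Type*} [LieRing L] [LieAlgebra K L]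

theorem nonempty_lieEquiv_of_injective {M : Type*} [LieRing M] [LieAlgebra K M]
    [FiniteDimensional K L] [FiniteDimensional K M] (f : L →ₗ[K] M) (hf : ∀ x, f x = 0 → x = 0)
    (hlie : ∀ x y, f ⁅x, y⁆ = ⁅f x, f y⁆) (h : finrank K L = finrank K M) :
    Nonempty (L ≃ₗ⁅K⁆ M) := by
  have hinj : Function.Injective f := by
    rw [← LinearMap.ker_eq_bot, LinearMap.ker_eq_bot']
    exact hf
  let e := LinearMap.linearEquivOfInjective f hinj h
  exact ⟨{ e with map_lie' := fun {x y} => hlie x y }⟩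

/-- Separating functionals with the right values on brackets are the coordinates of an isomorphism.
This turns each case of the classification into a choice of functionals. -/
theorem nonempty_lieEquiv_prod_ab {n m : ℕ} (D : BracketTable K n) (hL : finrank K L = n + m)
    [FiniteDimensional K L] (p : Fin n → Dual K L) (q : Fin m → Dual K L)
    (hsep : ∀ x, (∀ i, p i x = 0) → (∀ i, q i x = 0) → x = 0)
    (hp : ∀ (x y : L) i, p i ⁅x, y⁆ = D.br (fun j => p j x) (fun j => p j y) i)
    (hq : ∀ (i) (x y : L), q i ⁅x, y⁆ = 0) : Nonempty (L ≃ₗ⁅K⁆ D.Alg × Ab K m) := by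
  let P : L →ₗ[K] D.Alg := LinearMap.pi (φ := fun _ => K) p
  let Q : L →ₗ[K] Ab K m := LinearMap.pi (φ := fun _ => K) q
  refine nonempty_lieEquiv_of_injective (P.prod Q) (fun x hx => ?_) (fun x y => ?_) ?_
  · exact hsep x (fun i => congrFun (congrArg Prod.fst hx) i)
      (fun i => congrFun (congrArg Prod.snd hx) i)
  · exact Prod.ext (funext fun i => hp x y i) (funext fun i => hq i x y)
  · rw [finrank_prod, D.finrank_alg, BracketTable.finrank_alg, hL]

theorem nonempty_lieEquiv_prod_prod_ab {n n' m : ℕ} (D : BracketTable K n) (D' : BracketTable K n')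
    (hL : finrank K L = n + (n' + m)) [FiniteDimensional K L] (p : Fin n → Dual K L)
    (p' : Fin n' → Dual K L) (q : Fin m → Dual K L)
    (hsep : ∀ x, (∀ i, p i x = 0) → (∀ i, p' i x = 0) → (∀ i, q i x = 0) → x = 0)
    (hp : ∀ (x y : L) i, p i ⁅x, y⁆ = D.br (fun j => p j x) (fun j => p j y) i)
    (hp' : ∀ (x y : L) i, p' i ⁅x, y⁆ = D'.br (fun j => p' j x) (fun j => p' j y) i)
    (hq : ∀ (i) (x y : L), q i ⁅x, y⁆ = 0) : Nonempty (L ≃ₗ⁅K⁆ D.Alg × D'.Alg × Ab K m) := by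
  let P : L →ₗ[K] D.Alg := LinearMap.pi (φ := fun _ => K) p
  let P' : L →ₗ[K] D'.Alg := LinearMap.pi (φ := fun _ => K) p'
  let Q : L →ₗ[K] Ab K m := LinearMap.pi (φ := fun _ => K) q
  refine nonempty_lieEquiv_of_injective (P.prod (P'.prod Q)) (fun x hx => ?_) (fun x y => ?_) ?_
  · exact hsep x (fun i => congrFun (congrArg Prod.fst hx) i)
      (fun i => congrFun (congrArg (fun z => z.2.1) hx) i)
      (fun i => congrFun (congrArg (fun z => z.2.2) hx) i)
  · exact Prod.ext (funext fun i => hp x y i)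
      (Prod.ext (funext fun i => hp' x y i) (funext fun i => hq i x y))
  · rw [finrank_prod, finrank_prod, D.finrank_alg, D'.finrank_alg, BracketTable.finrank_alg, hL]

/-- The wedge product of two functionals, as a function of two vectors. -/
def wedge (f g : Dual K L) (x y : L) : K := f x * g y - g x * f y

/-- A central vector outside the span of all brackets splits off. -/
theorem isDecomposable_of_central {z : L} (hz : ∀ x : L, ⁅x, z⁆ = 0) (φ : Dual K L)
    (hφz : φ z = 1) (hφ : ∀ x y : L, φ ⁅x, y⁆ = 0) (hL : 1 < finrank K L) : IsDecomposable K L := by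
  have : FiniteDimensional K L := FiniteDimensional.of_finrank_pos (by omega)
  let I : LieIdeal K L :=
    { Submodule.span K {z} with
      lie_mem := fun {x m} hm => by
        obtain ⟨c, rfl⟩ := Submodule.mem_span_singleton.1 hm
        rw [lie_smul, hz, smul_zero]
        exact Submodule.zero_mem _ }
  let J : LieIdeal K L :=
    { LinearMap.ker φ with
      lie_mem := fun {x m} _ => hφ x m }
  have hI : ∀ x, x ∈ I ↔ ∃ c : K, c • z = x := fun x => Submodule.mem_span_singleton
  have hJ : ∀ x, x ∈ J ↔ φ x = 0 := fun x => Iff.rfl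
  refine ⟨I, J, fun h => ?_, fun h => ?_, ⟨?_, ?_⟩⟩
  · have : z ∈ I := (hI z).2 ⟨1, one_smul _ _⟩
    rw [h, LieSubmodule.mem_bot] at this
    rw [this, map_zero] at hφz
    exact zero_ne_one hφz
  · have hker : LinearMap.ker φ = ⊥ := by
      rw [LinearMap.ker_eq_bot']
      intro x hx
      have : x ∈ J := hx
      rwa [h, LieSubmodule.mem_bot] at this
    have := LinearMap.finrank_le_finrank_of_injective (LinearMap.ker_eq_bot.1 hker)
    rw [finrank_self] at this
    omega
  · rw [disjoint_iff_inf_le]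
    intro x hx
    rw [LieSubmodule.mem_inf, hI, hJ] at hx
    obtain ⟨⟨c, rfl⟩, h⟩ := hx
    rw [map_smul, hφz, smul_eq_mul, mul_one] at h
    rw [h, zero_smul]
    exact LieSubmodule.zero_mem _
  · rw [codisjoint_iff_le_sup]
    intro x _
    rw [LieSubmodule.mem_sup]
    exact ⟨φ x • z, (hI _).2 ⟨_, rfl⟩, x - φ x • z, by rw [hJ]; simp [hφz], by abel⟩

/-- Fewer functionals than the dimension have a common nonzero zero `z` of the `g i` and of
functionals dual to `w`. The `g i` make `z` central, and the dual functionals keep it out of the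
span of `w`. -/
theorem isDecomposable_of_functionals [FiniteDimensional K L] {k m : ℕ} (g : Fin k → Dual K L)
    (w : Fin m → L) (hw : LinearIndependent K w)
    (hbr : ∀ x y : L, ⁅x, y⁆ ∈ Submodule.span K (Set.range w))
    (hg : ∀ x, (∀ i, g i x = 0) → ∀ y : L, ⁅y, x⁆ = 0) (hL : k + m < finrank K L) (hm : 0 < m) :
    IsDecomposable K L := by
  obtain ⟨ω, hω⟩ := exists_dual_family hw
  have hker : 0 < finrank K (LinearMap.ker ((LinearMap.pi g).prod (LinearMap.pi ω))) := by
    have h1 := LinearMap.finrank_range_add_finrank_ker ((LinearMap.pi g).prod (LinearMap.pi ω))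
    have h2 := Submodule.finrank_le (LinearMap.range ((LinearMap.pi g).prod (LinearMap.pi ω)))
    rw [finrank_prod, finrank_fin_fun, finrank_fin_fun] at h2
    omega
  obtain ⟨⟨z, hz⟩, hz0⟩ := Module.finrank_pos_iff_exists_ne_zero.1 hker
  have hz1 : ∀ i, g i z = 0 := fun i => congrFun (congrArg Prod.fst hz) i
  have hz2 : ∀ i, ω i z = 0 := fun i => congrFun (congrArg Prod.snd hz) i
  have hzw : z ∉ Submodule.span K (Set.range w) := by
    intro hmem
    rw [Submodule.mem_span_range_iff_exists_fun] at hmem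
    obtain ⟨c, rfl⟩ := hmem
    have hc : ∀ i, c i = 0 := fun i => by simpa [hω] using hz2 i
    exact hz0 (Subtype.ext (by simp [hc]))
  obtain ⟨φ, hφz, hφ⟩ := Submodule.exists_le_ker_of_notMem hzw
  refine isDecomposable_of_central (hg z hz1) ((φ z)⁻¹ • φ) (by simp [hφz]) (fun x y => ?_)
    (by omega)
  have : φ ⁅x, y⁆ = 0 := hφ (hbr x y)
  simp [this]

end Isomorphisms

/-! ### Bracket maps of rank at most two -/

section RankTwo

open Module

variable {K : Type*} [Field K] {L : Type*} [LieRing L] [LieAlgebra K L]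

theorem det_eq_zero_of_finrank_range_le {V : Type*} [AddCommGroup V] [Module K V]
    [FiniteDimensional K V] {f : V →ₗ[K] V} (hf : finrank K (LinearMap.range f) ≤ 2)
    (ω : Fin 3 → Dual K V) (u : Fin 3 → V) :
    (Matrix.of fun i j => ω i (f (u j))).det = 0 := by
  have h : ¬ LinearIndependent K fun j => f.rangeRestrict (u j) := by
    intro h
    have := h.fintype_card_le_finrank
    rw [Fintype.card_fin] at this
    omega
  rw [Fintype.linearIndependent_iff] at h
  push Not at h
  obtain ⟨c, hc, i, hi⟩ := h
  have hc' : ∑ j, c j • f (u j) = 0 := by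
    simpa using congrArg (LinearMap.range f).subtype hc
  rw [← Matrix.exists_mulVec_eq_zero_iff]
  refine ⟨c, fun h0 => hi (congrFun h0 i), funext fun i => ?_⟩
  have := congrArg (ω i) hc'
  simp only [map_sum, map_smul, smul_eq_mul, map_zero] at this
  simp only [Matrix.mulVec, dotProduct, Matrix.of_apply, Pi.zero_apply]
  rw [← this]
  exact Finset.sum_congr rfl fun j _ => mul_comm _ _

/-- Perturb `x` to `x + t • y`. If ⁅y, z⁆ were independent of the plane, a 3×3 minor of the adjoint
map would be a cubic polynomial in `t` with linear coefficient 1, although the rank bound makes it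
vanish for every `t`. -/
theorem lie_mem_span_of_finrank_range_le [CharZero K] [FiniteDimensional K L]
    (h : ∀ y : L, finrank K (LinearMap.range (LieAlgebra.ad K L y)) ≤ 2) {x u v z : L}
    (huv : LinearIndependent K ![⁅x, u⁆, ⁅x, v⁆]) (hz : ⁅x, z⁆ = 0) (y : L) :
    ∃ s t : K, ⁅y, z⁆ = s • ⁅x, u⁆ + t • ⁅x, v⁆ := by
  by_contra hcon
  have hli : LinearIndependent K ![⁅y, z⁆, ⁅x, u⁆, ⁅x, v⁆] := by
    refine linearIndependent_finCons.2 ⟨huv, fun hmem => hcon ?_⟩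
    rw [Submodule.mem_span_range_iff_exists_fun] at hmem
    obtain ⟨c, hc⟩ := hmem
    exact ⟨c 0, c 1, by rw [← hc]; simp [Fin.sum_univ_two]⟩
  obtain ⟨ω, hω⟩ := exists_dual_family hli
  have hω' : ∀ i, ω i ⁅y, z⁆ = (if i = 0 then 1 else 0) ∧ ω i ⁅x, u⁆ = (if i = 1 then 1 else 0) ∧
      ω i ⁅x, v⁆ = if i = 2 then 1 else 0 := fun i => ⟨hω i 0, hω i 1, hω i 2⟩
  have key : ∀ t : K, t * (1 + t * (ω 1 ⁅y, u⁆ + ω 2 ⁅y, v⁆) +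
      t ^ 2 * (ω 1 ⁅y, u⁆ * ω 2 ⁅y, v⁆ - ω 2 ⁅y, u⁆ * ω 1 ⁅y, v⁆)) = 0 := by
    intro t
    have := det_eq_zero_of_finrank_range_le (h (x + t • y)) ω ![z, u, v]
    simp [Matrix.det_fin_three, hz, hω'] at this
    linear_combination this
  have h1 := key 1
  have h2 := key (-1)
  have h3 := key 2
  -- For p(t) = t + At² + Bt³ this combination of p(2), p(1), p(-1) cancels A and B.
  have : (6 : K) = 0 := by linear_combination -h3 + 6 * h1 - 2 * h2
  norm_num at this

end RankTwo

end SympLie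

namespace SympLie

/-! ### Normal forms of the bracket -/

section NormalForms

open Module

variable {K : Type*} [Field K] {L : Type*} [LieRing L] [LieAlgebra K L]

/-- Either the brackets span a plane, or the bracket is the universal one on three generators. -/
theorem IsSymplecticOfRankTwo.span_or_free [CharZero K] (h : IsSymplecticOfRankTwo K L) :
    (∃ x u v : L, LinearIndependent K ![⁅x, u⁆, ⁅x, v⁆] ∧
      ∀ y z : L, ∃ s t : K, ⁅y, z⁆ = s • ⁅x, u⁆ + t • ⁅x, v⁆) ∨
    ∃ (w : Fin 3 → L) (f g k : Dual K L), LinearIndependent K w ∧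
      LinearIndependent K ![f, g, k] ∧ (∀ i, f (w i) = 0 ∧ g (w i) = 0 ∧ k (w i) = 0) ∧
      ∀ x y : L, ⁅x, y⁆ = wedge f g x y • w 0 + wedge f k x y • w 1 + wedge g k x y • w 2 := by
  obtain ⟨hL, hnil, -, hle, x, hx⟩ := h
  have : FiniteDimensional K L := FiniteDimensional.of_finrank_pos (by omega)
  obtain ⟨B⟩ : Nonempty (Basis (Fin 2) K (LinearMap.range (LieAlgebra.ad K L x))) :=
    ⟨finBasisOfFinrankEq K _ hx⟩
  obtain ⟨u, hu⟩ := (B 0).2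
  obtain ⟨v, hv⟩ := (B 1).2
  rw [LieAlgebra.ad_apply] at hu hv
  have huv : LinearIndependent K ![⁅x, u⁆, ⁅x, v⁆] := by
    have h1 := B.linearIndependent.map' _ (Submodule.ker_subtype _)
    have h2 : ![⁅x, u⁆, ⁅x, v⁆] = (LinearMap.range (LieAlgebra.ad K L x)).subtype ∘ B := by
      ext i
      fin_cases i
      · simpa using hu
      · simpa using hv
    rwa [h2]
  have hspan : ∀ y : L, ∃ s t : K, ⁅x, y⁆ = s • ⁅x, u⁆ + t • ⁅x, v⁆ := by
    intro y
    have h1 := B.sum_repr ⟨⁅x, y⁆, y, rfl⟩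
    have h2 := congrArg (LinearMap.range (LieAlgebra.ad K L x)).subtype h1
    simp only [Fin.sum_univ_two, map_add, map_smul, Submodule.subtype_apply] at h2
    rw [← hu, ← hv] at h2
    exact ⟨_, _, h2.symm⟩
  -- The space is the span of `u`, `v` plus the centralizer of `x`, and brackets with the
  -- centralizer stay in the plane. So only ⁅u, v⁆ can leave it.
  have hC := fun z (hz : ⁅x, z⁆ = 0) y => lie_mem_span_of_finrank_range_le hle huv hz y
  by_cases hW : ∃ s t : K, ⁅u, v⁆ = s • ⁅x, u⁆ + t • ⁅x, v⁆
  · left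
    refine ⟨x, u, v, huv, fun y z => ?_⟩
    obtain ⟨s, t, hy⟩ := hspan y
    obtain ⟨s', t', hz⟩ := hspan z
    obtain ⟨p, q, hp⟩ := hW
    obtain ⟨y', rfl⟩ : ∃ y', y = s • u + t • v + y' := ⟨y - (s • u + t • v), by abel⟩
    obtain ⟨z', rfl⟩ : ∃ z', z = s' • u + t' • v + z' := ⟨z - (s' • u + t' • v), by abel⟩
    have hy' : ⁅x, y'⁆ = 0 := by simpa using hy
    have hz' : ⁅x, z'⁆ = 0 := by simpa using hz
    obtain ⟨a1, a2, ha⟩ := hC y' hy' (s' • u + t' • v + z')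
    obtain ⟨b1, b2, hb⟩ := hC z' hz' (s • u + t • v)
    refine ⟨b1 - a1 + (s * t' - t * s') * p, b2 - a2 + (s * t' - t * s') * q, ?_⟩
    rw [add_lie, ← lie_skew y', ha, lie_add _ _ z', hb]
    have hvu : ⁅v, u⁆ = -⁅u, v⁆ := (lie_skew _ _).symm
    simp only [lie_add, add_lie, lie_smul, smul_lie, lie_self, hvu, hp]
    module
  · right
    have hli : LinearIndependent K ![⁅x, u⁆, ⁅x, v⁆, ⁅u, v⁆] := by
      have h3 : LinearIndependent K ![⁅u, v⁆, ⁅x, u⁆, ⁅x, v⁆] := by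
        refine linearIndependent_finCons.2 ⟨huv, fun hmem => hW ?_⟩
        rw [Submodule.mem_span_range_iff_exists_fun] at hmem
        obtain ⟨c, hc⟩ := hmem
        exact ⟨c 0, c 1, by rw [← hc]; simp [Fin.sum_univ_two]⟩
      have h4 := h3.comp ![1, 2, 0] (by decide)
      convert h4 using 1
      ext i
      fin_cases i <;> rfl
    obtain ⟨ω, hω⟩ := exists_dual_family hli
    have hω' : ∀ i, ω i ⁅x, u⁆ = (if i = 0 then 1 else 0) ∧
        ω i ⁅x, v⁆ = (if i = 1 then 1 else 0) ∧ ω i ⁅u, v⁆ = if i = 2 then 1 else 0 :=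
      fun i => ⟨hω i 0, hω i 1, hω i 2⟩
    have hux : ⁅u, x⁆ = -⁅x, u⁆ := (lie_skew _ _).symm
    have hvx : ⁅v, x⁆ = -⁅x, v⁆ := (lie_skew _ _).symm
    have hvu : ⁅v, u⁆ = -⁅u, v⁆ := (lie_skew _ _).symm
    -- The rank bounds for `u`, `v` and `u + v` force `z` to act on `u` and `v` like a multiple of
    -- `x`.
    have hCuv : ∀ z, ⁅x, z⁆ = 0 → ⁅u, z⁆ = ω 0 ⁅u, z⁆ • ⁅x, u⁆ ∧ ⁅v, z⁆ = ω 0 ⁅u, z⁆ • ⁅x, v⁆ := by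
      intro z hz
      obtain ⟨α, β, h1⟩ := hC z hz u
      obtain ⟨α', β', h2⟩ := hC z hz v
      have d1 := det_eq_zero_of_finrank_range_le (hle u) ω ![x, v, z]
      have d2 := det_eq_zero_of_finrank_range_le (hle v) ω ![x, u, z]
      have d3 := det_eq_zero_of_finrank_range_le (hle (u + v)) ω ![x, u, z]
      simp [Matrix.det_fin_three, hux, hvx, hvu, h1, h2, hω', -lie_skew] at d1 d2 d3
      have e3 : α = β' := by linear_combination d3 - d2 + d1
      have e4 : ω 0 ⁅u, z⁆ = α := by rw [h1]; simp [hω']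
      rw [e4, h1, h2, d1, d2, e3]
      simp
    -- `z + c • x` commutes with `x`, `u` and `v`, so its bracket with `z'` lies in the ranges of
    -- all three adjoint maps. These are three planes with zero intersection.
    have hCC : ∀ z : L, ⁅x, z⁆ = 0 → ∀ z' : L, ⁅x, z'⁆ = 0 → ⁅z', z⁆ = 0 := by
      intro z hz z' hz'
      obtain ⟨hz1, hz2⟩ := hCuv z hz
      generalize ω 0 ⁅u, z⁆ = c at hz1 hz2
      have k1 : ⁅x, z + c • x⁆ = 0 := by simp [hz]
      have k2 : ⁅u, z + c • x⁆ = 0 := by simp [hz1, hux, -lie_skew]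
      have k3 : ⁅v, z + c • x⁆ = 0 := by simp [hz2, hvx, -lie_skew]
      have l2 : LinearIndependent K ![⁅u, x⁆, ⁅u, v⁆] := by
        rw [LinearIndependent.pair_iff]
        intro s t hst
        have e1 := congrArg (ω 0) hst
        have e2 := congrArg (ω 2) hst
        simp [hux, hω', -lie_skew] at e1 e2
        exact ⟨e1, e2⟩
      have l3 : LinearIndependent K ![⁅v, x⁆, ⁅v, u⁆] := by
        rw [LinearIndependent.pair_iff]
        intro s t hst
        have e1 := congrArg (ω 1) hst
        have e2 := congrArg (ω 2) hst
        simp [hvx, hvu, hω', -lie_skew] at e1 e2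
        exact ⟨e1, e2⟩
      obtain ⟨s1, t1, h1⟩ := hC _ k1 z'
      obtain ⟨s2, t2, h2⟩ := lie_mem_span_of_finrank_range_le hle l2 k2 z'
      obtain ⟨s3, t3, h3⟩ := lie_mem_span_of_finrank_range_le hle l3 k3 z'
      have e1 := congrArg (ω 1) (h1.symm.trans h2)
      have e2 := congrArg (ω 0) (h1.symm.trans h3)
      simp [hux, hvx, hvu, hω', -lie_skew] at e1 e2
      rw [e1, e2, lie_add, lie_smul, ← lie_skew z' x, hz'] at h1
      simpa using h1
    let p : Dual K L := (ω 0).comp (LieAlgebra.ad K L x)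
    let q : Dual K L := (ω 1).comp (LieAlgebra.ad K L x)
    -- `f`, `p`, `q` are dual to `x`, `u`, `v`; on the centralizer of `x`, `f` measures the multiple
    -- of `x` that a vector acts as.
    let f : Dual K L := -(ω 0).comp (LieAlgebra.ad K L u)
    have hp : ∀ y, p y = ω 0 ⁅x, y⁆ := fun y => rfl
    have hq : ∀ y, q y = ω 1 ⁅x, y⁆ := fun y => rfl
    have hf : ∀ y, f y = -ω 0 ⁅u, y⁆ := fun y => rfl
    refine ⟨![⁅x, u⁆, ⁅x, v⁆, ⁅u, v⁆], f, p, q, hli, ?_, ?_, ?_⟩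
    · rw [Fintype.linearIndependent_iff]
      intro c hc
      have e1 := LinearMap.congr_fun hc x
      have e2 := LinearMap.congr_fun hc u
      have e3 := LinearMap.congr_fun hc v
      simp [Fin.sum_univ_three, hp, hq, hf, hω', hux, -lie_skew] at e1 e2 e3
      simp [Fin.forall_fin_succ, *]
    · intro i
      fin_cases i <;> simp [hp, hq, hf, hnil]
    · intro y z
      obtain ⟨s, t, hy⟩ := hspan y
      obtain ⟨s', t', hz⟩ := hspan z
      obtain ⟨y', rfl⟩ : ∃ y', y = s • u + t • v + y' := ⟨y - (s • u + t • v), by abel⟩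
      obtain ⟨z', rfl⟩ : ∃ z', z = s' • u + t' • v + z' := ⟨z - (s' • u + t' • v), by abel⟩
      have hy' : ⁅x, y'⁆ = 0 := by simpa using hy
      have hz' : ⁅x, z'⁆ = 0 := by simpa using hz
      obtain ⟨y1, y2⟩ := hCuv y' hy'
      obtain ⟨z1, z2⟩ := hCuv z' hz'
      have hyz := hCC z' hz' y' hy'
      have fy : f (s • u + t • v + y') = -ω 0 ⁅u, y'⁆ := by simp [hf, hω']
      have fz : f (s' • u + t' • v + z') = -ω 0 ⁅u, z'⁆ := by simp [hf, hω']
      have py : p (s • u + t • v + y') = s := by simp [hp, hω', hy']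
      have pz : p (s' • u + t' • v + z') = s' := by simp [hp, hω', hz']
      have qy : q (s • u + t • v + y') = t := by simp [hq, hω', hy']
      have qz : q (s' • u + t' • v + z') = t' := by simp [hq, hω', hz']
      simp only [wedge, fy, fz, py, pz, qy, qz]
      generalize ω 0 ⁅u, y'⁆ = c at y1 y2 ⊢
      generalize ω 0 ⁅u, z'⁆ = d at z1 z2 ⊢
      have y1' : ⁅y', u⁆ = -(c • ⁅x, u⁆) := by rw [← lie_skew, y1]
      have y2' : ⁅y', v⁆ = -(c • ⁅x, v⁆) := by rw [← lie_skew, y2]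
      simp only [lie_add, add_lie, lie_smul, smul_lie, lie_self, hvu, hyz, y1', y2', z1, z2,
        Matrix.cons_val]
      module

end NormalForms

end SympLie

namespace SympLie

/-! ### Pencils of alternating forms -/

section Pencil

open Module

variable {K : Type*} [Field K] {L : Type*} [LieRing L] [LieAlgebra K L]

/-- The bracket is `(e₁ ∧ a + e₂ ∧ b) w₁ + (e₁ ∧ b + e₂ ∧ d) w₂`, with `w₁`, `w₂` a basis of the
derived algebra, on which all five functionals vanish. -/
structure PencilForm (w₁ w₂ : L) (e₁ e₂ a b d : Dual K L) : Prop where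
  w_indep : LinearIndependent K ![w₁, w₂]
  e_indep : LinearIndependent K ![e₁, e₂]
  e₁_w : e₁ w₁ = 0 ∧ e₁ w₂ = 0
  e₂_w : e₂ w₁ = 0 ∧ e₂ w₂ = 0
  a_w : a w₁ = 0 ∧ a w₂ = 0
  b_w : b w₁ = 0 ∧ b w₂ = 0
  d_w : d w₁ = 0 ∧ d w₂ = 0
  derived : ∀ φ : Dual K L, (∀ x y : L, φ ⁅x, y⁆ = 0) → φ w₁ = 0 ∧ φ w₂ = 0
  bracket : ∀ x y : L, ⁅x, y⁆ = (wedge e₁ a x y + wedge e₂ b x y) • w₁ +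
    (wedge e₁ b x y + wedge e₂ d x y) • w₂

theorem exists_vectors_of_dual_indep [FiniteDimensional K L] {ι : Type*} [Fintype ι]
    [DecidableEq ι] {g : ι → Dual K L} (hg : LinearIndependent K g) :
    ∃ u : ι → L, ∀ i j, g i (u j) = if i = j then 1 else 0 := by
  obtain ⟨ω, hω⟩ := exists_dual_family hg
  refine ⟨fun i => (evalEquiv K L).symm (ω i), fun i j => ?_⟩
  rw [apply_evalEquiv_symm_apply, hω]
  simp only [eq_comm]

/-- The closedness of the symplectic form puts the bracket in pencil form. -/
theorem IsSymplectic.exists_pencilForm [FiniteDimensional K L] (hs : IsSymplectic K L)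
    {w₁ w₂ : L} (hw : LinearIndependent K ![w₁, w₂])
    (hspan : ∀ x y : L, ∃ s t : K, ⁅x, y⁆ = s • w₁ + t • w₂)
    (hw₁ : ∃ x y : L, ⁅x, y⁆ = w₁) (hw₂ : ∃ x y : L, ⁅x, y⁆ = w₂)
    (hc₁ : ∀ x : L, ⁅x, w₁⁆ = 0) (hc₂ : ∀ x : L, ⁅x, w₂⁆ = 0) :
    ∃ e₁ e₂ a b d : Dual K L, PencilForm w₁ w₂ e₁ e₂ a b d := by
  obtain ⟨θ, halt, ⟨hl, -⟩, hcl⟩ := hs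
  obtain ⟨ω, hω⟩ := exists_dual_family hw
  have hω₁ : ∀ i, ω i w₁ = if i = 0 then 1 else 0 := fun i => hω i 0
  have hω₂ : ∀ i, ω i w₂ = if i = 1 then 1 else 0 := fun i => hω i 1
  have hbr : ∀ x y : L, ⁅x, y⁆ = ω 0 ⁅x, y⁆ • w₁ + ω 1 ⁅x, y⁆ • w₂ := by
    intro x y
    obtain ⟨s, t, h⟩ := hspan x y
    have h0 : ω 0 ⁅x, y⁆ = s := by rw [h]; simp [hω₁, hω₂]
    have h1 : ω 1 ⁅x, y⁆ = t := by rw [h]; simp [hω₁, hω₂]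
    rw [h0, h1, h]
  -- Closedness makes the centre orthogonal to the derived algebra, so θ w₁ and θ w₂ vanish on w₁
  -- and w₂.
  have hcent : ∀ w : L, (∀ x : L, ⁅x, w⁆ = 0) → ∀ x y : L, θ w ⁅x, y⁆ = 0 := by
    intro w hw x y
    have := hcl x y w
    rw [hw y, ← lie_skew w x, hw x, neg_zero, map_zero, LinearMap.zero_apply,
      LinearMap.zero_apply, add_zero, add_zero] at this
    rw [← LinearMap.IsAlt.neg halt, this, neg_zero]
  have hθw : ∀ w : L, (∀ x : L, ⁅x, w⁆ = 0) → θ w w₁ = 0 ∧ θ w w₂ = 0 := by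
    obtain ⟨x, y, rfl⟩ := hw₁
    obtain ⟨x', y', rfl⟩ := hw₂
    exact fun w hw => ⟨hcent w hw x y, hcent w hw x' y'⟩
  have he : LinearIndependent K ![θ w₁, θ w₂] := by
    have hinj : LinearMap.ker θ = ⊥ := by
      rw [LinearMap.ker_eq_bot']
      intro x hx
      exact hl x fun y => LinearMap.congr_fun hx y
    have h1 := hw.map' θ hinj
    have h2 : ![θ w₁, θ w₂] = θ ∘ ![w₁, w₂] := by
      ext i
      fin_cases i <;> rfl
    rwa [h2]
  obtain ⟨u, hu⟩ := exists_vectors_of_dual_indep he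
  have hu1 : θ w₁ (u 0) = 1 := hu 0 0
  have hu2 : θ w₁ (u 1) = 0 := hu 0 1
  have hu3 : θ w₂ (u 0) = 0 := hu 1 0
  have hu4 : θ w₂ (u 1) = 1 := hu 1 1
  have hclosed : ∀ x y z : L, (ω 0 ⁅x, y⁆ * θ w₁ z + ω 1 ⁅x, y⁆ * θ w₂ z) +
      (ω 0 ⁅y, z⁆ * θ w₁ x + ω 1 ⁅y, z⁆ * θ w₂ x) +
      (ω 0 ⁅z, x⁆ * θ w₁ y + ω 1 ⁅z, x⁆ * θ w₂ y) = 0 := by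
    intro x y z
    have := hcl x y z
    rw [hbr x y, hbr y z, hbr z x] at this
    simpa using this
  have hskew : ∀ (i : Fin 2) (x y : L), ω i ⁅x, y⁆ = -ω i ⁅y, x⁆ := by
    intro i x y
    rw [← lie_skew, map_neg]
  -- `a`, `b`, `d` are contractions of the 2-forms with `u 0`, `u 1`. Both `a` and the contraction
  -- in `b` carry the component of the first form along θ w₁ ∧ θ w₂; the multiple of θ w₁ removes
  -- this double count.
  refine ⟨θ w₁, θ w₂, (ω 0).comp (LieAlgebra.ad K L (u 0)),
    (ω 0).comp (LieAlgebra.ad K L (u 1)) + ω 0 ⁅u 0, u 1⁆ • θ w₁,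
    (ω 1).comp (LieAlgebra.ad K L (u 1)), hw, he, hθw _ hc₁, hθw _ hc₂, ?_, ?_, ?_, ?_, ?_⟩
  · simp [hc₁, hc₂]
  · simp [hc₁, hc₂, hθw _ hc₁]
  · simp [hc₁, hc₂]
  · intro φ hφ
    obtain ⟨x, y, rfl⟩ := hw₁
    obtain ⟨x', y', rfl⟩ := hw₂
    exact ⟨hφ x y, hφ x' y'⟩
  · intro x y
    have k1 := hclosed x y (u 0)
    have k2 := hclosed x y (u 1)
    have k3 := hclosed (u 0) (u 1) x
    have k4 := hclosed (u 0) (u 1) y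
    simp only [hu1, hu2, hu3, hu4, hskew _ x (u 0), hskew _ y (u 0),
      hskew _ y (u 1)] at k1 k2 k3 k4
    have c1 : ω 0 ⁅x, y⁆ = wedge (θ w₁) ((ω 0).comp (LieAlgebra.ad K L (u 0))) x y +
        wedge (θ w₂) ((ω 0).comp (LieAlgebra.ad K L (u 1)) + ω 0 ⁅u 0, u 1⁆ • θ w₁) x y := by
      simp only [wedge, LinearMap.add_apply, LinearMap.smul_apply, LinearMap.comp_apply,
        LieAlgebra.ad_apply, smul_eq_mul]
      linear_combination k1 - θ w₂ x * k4 + θ w₂ y * k3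
    have c2 : ω 1 ⁅x, y⁆ = wedge (θ w₁)
          ((ω 0).comp (LieAlgebra.ad K L (u 1)) + ω 0 ⁅u 0, u 1⁆ • θ w₁) x y +
        wedge (θ w₂) ((ω 1).comp (LieAlgebra.ad K L (u 1))) x y := by
      simp only [wedge, LinearMap.add_apply, LinearMap.smul_apply, LinearMap.comp_apply,
        LieAlgebra.ad_apply, smul_eq_mul]
      linear_combination k2
    rw [← c1, ← c2]
    exact hbr x y

variable {w₁ w₂ : L} {e₁ e₂ a b d : Dual K L}

theorem PencilForm.isDecomposable (h : PencilForm w₁ w₂ e₁ e₂ a b d) (hL : finrank K L = 8) :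
    IsDecomposable K L := by
  have : FiniteDimensional K L := FiniteDimensional.of_finrank_pos (by omega)
  refine isDecomposable_of_functionals ![e₁, e₂, a, b, d] ![w₁, w₂] h.w_indep (fun x y => ?_)
    (fun x hx y => ?_) (by omega) (by omega)
  · rw [h.bracket]
    exact Submodule.add_mem _ (Submodule.smul_mem _ _ (Submodule.subset_span ⟨0, rfl⟩))
      (Submodule.smul_mem _ _ (Submodule.subset_span ⟨1, rfl⟩))
  · simp [Fin.forall_fin_succ] at hx
    simp [h.bracket, wedge, hx]

theorem PencilForm.swap (h : PencilForm w₁ w₂ e₁ e₂ a b d) : PencilForm w₂ w₁ e₂ e₁ d b a where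
  w_indep := LinearIndependent.pair_symm_iff.1 h.w_indep
  e_indep := LinearIndependent.pair_symm_iff.1 h.e_indep
  e₁_w := h.e₂_w.symm
  e₂_w := h.e₁_w.symm
  a_w := h.d_w.symm
  b_w := h.b_w.symm
  d_w := h.a_w.symm
  derived φ hφ := (h.derived φ hφ).symm
  bracket x y := by
    rw [h.bracket]
    module

theorem linearIndependent_pair_sub_smul {V : Type*} [AddCommGroup V] [Module K V] {x y : V}
    (h : LinearIndependent K ![x, y]) (κ : K) : LinearIndependent K ![x, y - κ • x] := by
  rw [LinearIndependent.pair_iff] at h ⊢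
  intro s t hst
  obtain ⟨h1, h2⟩ := h (s - t * κ) t (by rw [← hst]; module)
  subst h2
  exact ⟨by simpa using h1, rfl⟩

/-- The bracket is ∑ (eᵢ∧Sᵢⱼ) wⱼ with S symmetric. When the wⱼ and the eᵢ undergo the same shear, S
changes by congruence. -/
theorem PencilForm.shear (h : PencilForm w₁ w₂ e₁ e₂ a b d) (κ : K) :
    PencilForm w₁ (w₂ - κ • w₁) e₁ (e₂ - κ • e₁) (a + (2 * κ) • b + κ ^ 2 • d) (b + κ • d) d where
  w_indep := linearIndependent_pair_sub_smul h.w_indep κ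
  e_indep := linearIndependent_pair_sub_smul h.e_indep κ
  e₁_w := by simp [h.e₁_w]
  e₂_w := by simp [h.e₁_w, h.e₂_w]
  a_w := by simp [h.a_w, h.b_w, h.d_w]
  b_w := by simp [h.b_w, h.d_w]
  d_w := by simp [h.d_w]
  derived φ hφ := by simp [h.derived φ hφ]
  bracket x y := by
    rw [h.bracket]
    simp only [wedge, LinearMap.add_apply, LinearMap.sub_apply, LinearMap.smul_apply, smul_eq_mul]
    module

/-- A relation involving `d` can be brought to the form `d = μ a`. -/
theorem PencilForm.exists_diagonal_of_relation [CharZero K] (h : PencilForm w₁ w₂ e₁ e₂ a b d)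
    {s t α β : K} (hd : d = s • e₁ + t • e₂ + α • a + β • b) :
    ∃ (w₁' w₂' : L) (e₁' e₂' a' b' : Dual K L) (μ : K),
      PencilForm w₁' w₂' e₁' e₂' a' b' (μ • a') := by
  -- Completing the square: the sheared d + 2κb + κ²a no longer involves b. Its e₂ term dies against
  -- e₂, and e₂ ∧ s e₁ = e₁ ∧ (-s e₂) moves the e₁ term into b.
  obtain ⟨κ, hκ⟩ : ∃ κ : K, β = -2 * κ := ⟨-β / 2, by ring⟩
  have h1 := (h.swap.shear κ).swap
  refine ⟨_, _, e₁ - κ • e₂, e₂, a, b + κ • a - s • e₂, α + κ ^ 2, h1.w_indep, h1.e_indep,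
    h1.e₁_w, h1.e₂_w, h1.a_w, ?_, ?_, h1.derived, fun x y => ?_⟩
  · simp [h.b_w, h.a_w, h.e₂_w]
  · simp [h.a_w]
  · rw [h1.bracket, hd, hκ]
    simp only [wedge, LinearMap.add_apply, LinearMap.sub_apply, LinearMap.smul_apply, smul_eq_mul]
    module

theorem PencilForm.exists_diagonal [CharZero K] (h : PencilForm w₁ w₂ e₁ e₂ a b d)
    (hdep : ¬ LinearIndependent K ![e₁, e₂, a, b, d]) :
    ∃ (w₁' w₂' : L) (e₁' e₂' a' b' : Dual K L) (μ : K),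
      PencilForm w₁' w₂' e₁' e₂' a' b' (μ • a') := by
  rw [Fintype.linearIndependent_iff] at hdep
  push Not at hdep
  obtain ⟨c, hc, i, hi⟩ := hdep
  simp only [Fin.sum_univ_five, Matrix.cons_val] at hc
  by_cases h4 : c 4 = 0
  · by_cases h2 : c 2 = 0
    · by_cases h3 : c 3 = 0
      · exfalso
        have := LinearIndependent.pair_iff.1 h.e_indep (c 0) (c 1) (by
          rw [← hc, h2, h3, h4]; module)
        fin_cases i <;> simp_all
      -- Here only b lies in the span of e₁, e₂. After the shear the middle entry is b + d, so d
      -- equals it minus b and the relation involves d.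
      · refine (h.shear 1).exists_diagonal_of_relation (s := (c 3)⁻¹ * (c 0 + c 1))
          (t := (c 3)⁻¹ * c 1) (α := 0) (β := 1) ?_
        rw [h2, h4] at hc
        have hb : b = -((c 3)⁻¹ * c 0) • e₁ - ((c 3)⁻¹ * c 1) • e₂ := by
          have e1 : c 3 • b = -(c 0 • e₁) - c 1 • e₂ := by linear_combination (norm := module) hc
          rw [← inv_smul_smul₀ h3 b, e1]
          module
        rw [hb]
        module
    · refine h.swap.exists_diagonal_of_relation (s := -((c 2)⁻¹ * c 1))
        (t := -((c 2)⁻¹ * c 0)) (α := -((c 2)⁻¹ * c 4)) (β := -((c 2)⁻¹ * c 3)) ?_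
      have e1 : c 2 • a = -(c 0 • e₁) - c 1 • e₂ - c 3 • b - c 4 • d := by
        linear_combination (norm := module) hc
      rw [← inv_smul_smul₀ h2 a, e1]
      module
  · refine h.exists_diagonal_of_relation (s := -((c 4)⁻¹ * c 0))
      (t := -((c 4)⁻¹ * c 1)) (α := -((c 4)⁻¹ * c 2)) (β := -((c 4)⁻¹ * c 3)) ?_
    have e1 : c 4 • d = -(c 0 • e₁) - c 1 • e₂ - c 2 • a - c 3 • b := by
      linear_combination (norm := module) hc
    rw [← inv_smul_smul₀ h4 d, e1]
    module

end Pencil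

end SympLie

namespace SympLie

/-! ### Classification -/

section Classification

open Module

variable {K : Type*} [Field K] {L : Type*} [LieRing L] [LieAlgebra K L]
  {w₁ w₂ : L} {e₁ e₂ a b d : Dual K L}

theorem PencilForm.nonempty_n7_124 (h : PencilForm w₁ w₂ e₁ e₂ a b d) (hL : finrank K L = 8)
    (hli : LinearIndependent K ![e₁, e₂, a, b, d]) :
    Nonempty (L ≃ₗ⁅K⁆ N7_124 K × Ab K 1) := by
  have : FiniteDimensional K L := FiniteDimensional.of_finrank_pos (by omega)
  obtain ⟨χ, ω, hχ, hω, hsep⟩ := exists_adapted_functionals (j := 1) hli h.w_indep (by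
    simp [Fin.forall_fin_succ, h.e₁_w, h.e₂_w, h.a_w, h.b_w, h.d_w]) hL
  simp [Fin.forall_fin_succ] at hχ hω hsep
  refine nonempty_lieEquiv_prod_ab (n7_124Table K) hL ![e₁, a, ω 0, b, ω 1, d, -e₂] χ
    (fun x h1 h2 => ?_) (fun x y i => ?_) (fun i x y => ?_)
  · simp [Fin.forall_fin_succ] at h1 h2
    apply hsep <;> simp [h1, h2]
  · rw [n7_124Table_br, h.bracket]
    fin_cases i <;> simp [wedge, h.e₁_w, h.e₂_w, h.a_w, h.b_w, h.d_w, hω] <;> ring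
  · rw [h.bracket, Subsingleton.elim i 0]
    simp [hχ]

theorem PencilForm.nonempty_n6_19 {μ : K} (h : PencilForm w₁ w₂ e₁ e₂ a b (μ • a))
    (hL : finrank K L = 8) (hli : LinearIndependent K ![e₁, e₂, a, b]) (hμ : μ = 0) :
    Nonempty (L ≃ₗ⁅K⁆ N6_19 K × Ab K 2) := by
  have : FiniteDimensional K L := FiniteDimensional.of_finrank_pos (by omega)
  obtain ⟨χ, ω, hχ, hω, hsep⟩ := exists_adapted_functionals (j := 2) hli h.w_indep (by
    simp [Fin.forall_fin_succ, h.e₁_w, h.e₂_w, h.a_w, h.b_w]) hL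
  simp [Fin.forall_fin_succ] at hχ hω hsep
  refine nonempty_lieEquiv_prod_ab (n6_19Table K) hL ![e₁, b, ω 1, a, ω 0, -e₂] χ
    (fun x h1 h2 => ?_) (fun x y i => ?_) (fun i x y => ?_)
  · simp [Fin.forall_fin_succ] at h1 h2
    apply hsep <;> simp [h1, h2]
  · rw [n6_19Table_br, h.bracket, hμ]
    fin_cases i <;> simp [wedge, h.e₁_w, h.e₂_w, h.a_w, h.b_w, hω]
    ring
  · rw [h.bracket]
    fin_cases i <;> simp [hχ]

theorem PencilForm.nonempty_n6_20_1 {μ : K} (h : PencilForm w₁ w₂ e₁ e₂ a b (μ • a))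
    (hL : finrank K L = 8) (hli : LinearIndependent K ![e₁, e₂, a, b]) {k : K} (hk : k ≠ 0)
    (hμ : μ = -k ^ 2) : Nonempty (L ≃ₗ⁅K⁆ N6_20_1 K × Ab K 2) := by
  have : FiniteDimensional K L := FiniteDimensional.of_finrank_pos (by omega)
  obtain ⟨χ, ω, hχ, hω, hsep⟩ := exists_adapted_functionals (j := 2) hli h.w_indep (by
    simp [Fin.forall_fin_succ, h.e₁_w, h.e₂_w, h.a_w, h.b_w]) hL
  simp [Fin.forall_fin_succ] at hχ hω hsep
  refine nonempty_lieEquiv_prod_ab (n6_20_1Table K) hL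
    ![e₁, k • a, k • ω 0, b, ω 1, -k • e₂] χ
    (fun x h1 h2 => ?_) (fun x y i => ?_) (fun i x y => ?_)
  · simp [Fin.forall_fin_succ, hk] at h1 h2
    apply hsep <;> simp [h1, h2]
  · rw [n6_20_1Table_br, h.bracket, hμ]
    fin_cases i <;> simp [wedge, h.e₁_w, h.e₂_w, h.a_w, h.b_w, hω] <;> ring
  · rw [h.bracket]
    fin_cases i <;> simp [hχ]

/-- The combinations ω₂ ± kω₁ are the decomposable forms (e₁ ± k e₂)∧(b ± k a), one for each
Heisenberg factor. -/
theorem PencilForm.nonempty_n3_1_n3_1 [CharZero K] {μ : K}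
    (h : PencilForm w₁ w₂ e₁ e₂ a b (μ • a))
    (hL : finrank K L = 8) (hli : LinearIndependent K ![e₁, e₂, a, b]) {k : K} (hk : k ≠ 0)
    (hμ : μ = k ^ 2) : Nonempty (L ≃ₗ⁅K⁆ N3_1 K × N3_1 K × Ab K 2) := by
  have : FiniteDimensional K L := FiniteDimensional.of_finrank_pos (by omega)
  obtain ⟨χ, ω, hχ, hω, hsep⟩ := exists_adapted_functionals (j := 2) hli h.w_indep (by
    simp [Fin.forall_fin_succ, h.e₁_w, h.e₂_w, h.a_w, h.b_w]) hL
  simp [Fin.forall_fin_succ] at hχ hω hsep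
  have hzero : ∀ p q : K, p + k * q = 0 → p - k * q = 0 → p = 0 ∧ q = 0 := by
    intro p q h1 h2
    have hp : 2 * p = 0 := by linear_combination h1 + h2
    have hq : (2 * k) * q = 0 := by linear_combination h1 - h2
    simpa [hk] using And.intro hp hq
  refine nonempty_lieEquiv_prod_prod_ab (n3_1Table K) (n3_1Table K) hL
    ![e₁ + k • e₂, b + k • a, ω 1 + k • ω 0] ![e₁ - k • e₂, b - k • a, ω 1 - k • ω 0] χ
    (fun x h1 h2 h3 => ?_) (fun x y i => ?_) (fun x y i => ?_) (fun i x y => ?_)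
  · simp only [Fin.forall_fin_succ, Matrix.cons_val_zero, Matrix.cons_val_succ,
      LinearMap.add_apply, LinearMap.sub_apply, LinearMap.smul_apply, smul_eq_mul] at h1 h2 h3
    have k1 := hzero _ _ h1.1 h2.1
    have k2 := hzero _ _ h1.2.1 h2.2.1
    have k3 := hzero _ _ h1.2.2.1 h2.2.2.1
    exact hsep x k1.1 k1.2 k2.2 k2.1 h3.1 h3.2.1 k3.2 k3.1
  · rw [n3_1Table_br, h.bracket, hμ]
    fin_cases i <;> simp [wedge, h.e₁_w, h.e₂_w, h.a_w, h.b_w, hω]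
    ring
  · rw [n3_1Table_br, h.bracket, hμ]
    fin_cases i <;> simp [wedge, h.e₁_w, h.e₂_w, h.a_w, h.b_w, hω]
    ring
  · rw [h.bracket]
    fin_cases i <;> simp [hχ]

theorem nonempty_n5_5 {f g k : Dual K L} (hw : LinearIndependent K ![w₁, w₂])
    (hf : f w₁ = 0 ∧ f w₂ = 0) (hg : g w₁ = 0 ∧ g w₂ = 0) (hk : k w₁ = 0 ∧ k w₂ = 0)
    (hder : ∀ φ : Dual K L, (∀ x y : L, φ ⁅x, y⁆ = 0) → φ w₁ = 0 ∧ φ w₂ = 0)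
    (hbr : ∀ x y : L, ⁅x, y⁆ = wedge f g x y • w₁ + wedge f k x y • w₂)
    (hL : finrank K L = 8) : Nonempty (L ≃ₗ⁅K⁆ N5_5 K × Ab K 3) := by
  have : FiniteDimensional K L := FiniteDimensional.of_finrank_pos (by omega)
  -- A relation c₀f + c₁g + c₂k = 0 makes f∧(c₁g + c₂k) zero, so c₁ω₀ + c₂ω₁ kills all brackets and
  -- c₁ = c₂ = 0 by `hder`. Then c₀ ≠ 0 would give f = 0 and a zero bracket.
  have hli : LinearIndependent K ![f, g, k] := by
    obtain ⟨ω, hω⟩ := exists_dual_family hw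
    have hω₁ : ∀ i, ω i w₁ = if i = 0 then 1 else 0 := fun i => hω i 0
    have hω₂ : ∀ i, ω i w₂ = if i = 1 then 1 else 0 := fun i => hω i 1
    rw [Fintype.linearIndependent_iff]
    intro c hc
    have hc' : ∀ x, c 0 * f x + c 1 * g x + c 2 * k x = 0 := by
      intro x
      simpa [Fin.sum_univ_three] using LinearMap.congr_fun hc x
    have h1 := hder (c 1 • ω 0 + c 2 • ω 1) (fun x y => by
      rw [hbr]
      simp [hω₁, hω₂, wedge]
      linear_combination f x * hc' y - f y * hc' x)
    simp [hω₁, hω₂] at h1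
    have h0 : c 0 = 0 := by
      by_contra h0
      have hf0 : ∀ x, f x = 0 := by
        intro x
        have := hc' x
        simpa [h1, h0] using this
      have := hder (ω 0) (fun x y => by simp [hbr, wedge, hf0])
      simp [hω₁] at this
    simp [Fin.forall_fin_succ, h0, h1]
  obtain ⟨χ, ω, hχ, hω, hsep⟩ := exists_adapted_functionals (j := 3) hli hw (by
    simp [Fin.forall_fin_succ, hf, hg, hk]) hL
  simp [Fin.forall_fin_succ] at hχ hω hsep
  refine nonempty_lieEquiv_prod_ab (n5_5Table K) hL ![f, g, ω 0, k, ω 1] χ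
    (fun x h1 h2 => ?_) (fun x y i => ?_) (fun i x y => ?_)
  · simp [Fin.forall_fin_succ] at h1 h2
    apply hsep <;> simp [h1, h2]
  · rw [n5_5Table_br, hbr]
    fin_cases i <;> simp [wedge, hf, hg, hk, hω]
  · rw [hbr]
    fin_cases i <;> simp [hχ]

theorem nonempty_n6_20 {w : Fin 3 → L} {f g k : Dual K L} (hw : LinearIndependent K w)
    (hli : LinearIndependent K ![f, g, k]) (hv : ∀ i, f (w i) = 0 ∧ g (w i) = 0 ∧ k (w i) = 0)
    (hbr : ∀ x y : L, ⁅x, y⁆ =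
      wedge f g x y • w 0 + wedge f k x y • w 1 + wedge g k x y • w 2)
    (hL : finrank K L = 8) : Nonempty (L ≃ₗ⁅K⁆ N6_20 K × Ab K 2) := by
  have : FiniteDimensional K L := FiniteDimensional.of_finrank_pos (by omega)
  obtain ⟨χ, ω, hχ, hω, hsep⟩ := exists_adapted_functionals (j := 2) hli hw (by
    simp [Fin.forall_fin_succ, hv]) hL
  simp [Fin.forall_fin_succ] at hχ hω hsep
  refine nonempty_lieEquiv_prod_ab (n6_20Table K) hL ![f, g, ω 0, k, ω 1, ω 2] χ
    (fun x h1 h2 => ?_) (fun x y i => ?_) (fun i x y => ?_)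
  · simp [Fin.forall_fin_succ] at h1 h2
    apply hsep <;> simp [h1, h2]
  · rw [n6_20Table_br, hbr]
    fin_cases i <;> simp [wedge, hv, hω]
  · rw [hbr]
    fin_cases i <;> simp [hχ]

theorem PencilForm.nonempty_n5_5 {μ : K} (h : PencilForm w₁ w₂ e₁ e₂ a b (μ • a))
    (hL : finrank K L = 8) (hdep : ¬ LinearIndependent K ![e₁, e₂, a, b]) :
    Nonempty (L ≃ₗ⁅K⁆ N5_5 K × Ab K 3) := by
  rw [Fintype.linearIndependent_iff] at hdep
  push Not at hdep
  obtain ⟨c, hc, i, hi⟩ := hdep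
  simp only [Fin.sum_univ_four, Matrix.cons_val] at hc
  by_cases h3 : c 3 = 0
  · by_cases h2 : c 2 = 0
    · exfalso
      have := LinearIndependent.pair_iff.1 h.e_indep (c 0) (c 1) (by
        rw [← hc, h2, h3]; module)
      fin_cases i <;> simp_all
    · obtain ⟨s, t, ha⟩ : ∃ s t : K, a = s • e₁ + t • e₂ := by
        refine ⟨-((c 2)⁻¹ * c 0), -((c 2)⁻¹ * c 1), ?_⟩
        have e1 : c 2 • a = -(c 0 • e₁) - c 1 • e₂ := by
          rw [h3] at hc
          linear_combination (norm := module) hc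
        rw [← inv_smul_smul₀ h2 a, e1]
        module
      refine SympLie.nonempty_n5_5 (f := b - t • e₁ - (μ * s) • e₂) (g := -e₂) (k := -e₁)
        h.w_indep ?_ ?_ ?_ h.derived (fun x y => ?_) hL
      · simp [h.b_w, h.e₁_w, h.e₂_w]
      · simp [h.e₂_w]
      · simp [h.e₁_w]
      · rw [h.bracket, ha]
        simp only [wedge, LinearMap.add_apply, LinearMap.sub_apply, LinearMap.smul_apply,
          LinearMap.neg_apply, smul_eq_mul]
        module
  · obtain ⟨s, t, ν, hb⟩ : ∃ s t ν : K, b = s • e₁ + t • e₂ + ν • a := by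
      refine ⟨-((c 3)⁻¹ * c 0), -((c 3)⁻¹ * c 1), -((c 3)⁻¹ * c 2), ?_⟩
      have e1 : c 3 • b = -(c 0 • e₁) - c 1 • e₂ - c 2 • a := by
        linear_combination (norm := module) hc
      rw [← inv_smul_smul₀ h3 b, e1]
      module
    -- Modulo e₁∧e₂ the two forms are (e₁ + νe₂)∧a and (νe₁ + μe₂)∧a. If the determinant μ - ν²
    -- vanishes, e₁ + νe₂ is the common factor after changing w₁. Otherwise these two functionals
    -- span the same plane as e₁, e₂, and correcting a inside it absorbs the e₁∧e₂ terms.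
    by_cases hμ : μ - ν ^ 2 = 0
    · have hμ' : μ = ν ^ 2 := sub_eq_zero.1 hμ
      have hw : LinearIndependent K ![w₁ + ν • w₂, w₂] := by
        have := linearIndependent_pair_sub_smul
          (LinearIndependent.pair_symm_iff.1 h.w_indep) (-ν)
        rw [neg_smul, sub_neg_eq_add] at this
        exact LinearIndependent.pair_symm_iff.1 this
      refine SympLie.nonempty_n5_5 (f := e₁ + ν • e₂) (g := a - s • e₂) (k := (t + ν * s) • e₂)
        hw ?_ ?_ ?_ (fun φ hφ => ?_) (fun x y => ?_) hL
      · simp [h.e₁_w, h.e₂_w]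
      · simp [h.a_w, h.e₂_w]
      · simp [h.e₂_w]
      · simp [h.derived φ hφ]
      · rw [h.bracket, hb, hμ']
        simp only [wedge, LinearMap.add_apply, LinearMap.sub_apply, LinearMap.smul_apply,
          smul_eq_mul]
        module
    · obtain ⟨x₀, y₀, hs, ht⟩ : ∃ x₀ y₀ : K, s = -((μ - ν ^ 2) * y₀) ∧
          t = -((μ - ν ^ 2) * x₀) := by
        refine ⟨-(μ - ν ^ 2)⁻¹ * t, -(μ - ν ^ 2)⁻¹ * s, ?_, ?_⟩ <;> field_simp
      refine SympLie.nonempty_n5_5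
        (f := a + x₀ • (e₁ + ν • e₂) + y₀ • (ν • e₁ + μ • e₂)) (g := -(e₁ + ν • e₂))
        (k := -(ν • e₁ + μ • e₂)) h.w_indep ?_ ?_ ?_ h.derived (fun x y => ?_) hL
      · simp [h.a_w, h.e₁_w, h.e₂_w]
      · simp [h.e₁_w, h.e₂_w]
      · simp [h.e₁_w, h.e₂_w]
      · rw [h.bracket, hb, hs, ht]
        simp only [wedge, LinearMap.add_apply, LinearMap.smul_apply, LinearMap.neg_apply,
          smul_eq_mul]
        module

end Classification

end SympLie

namespace SympLie

/-! ### Decomposability, the classification over characteristic zero, and the component C₁. -/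

section Main

open Module

theorem IsInCommonList.isSymplecticOfRankTwo {K : Type*} [Field K] {L : Type*} [LieRing L]
    [LieAlgebra K L] (h : IsInCommonList K L) : IsSymplecticOfRankTwo K L := by
  rcases h with ⟨⟨e⟩⟩ | ⟨⟨e⟩⟩ | ⟨⟨e⟩⟩ | ⟨⟨e⟩⟩ | ⟨⟨e⟩⟩
  · exact (isSymplecticOfRankTwo_n7_124 K).of_equiv e
  · exact (isSymplecticOfRankTwo_n6_19 K).of_equiv e
  · exact (isSymplecticOfRankTwo_n6_20 K).of_equiv e
  · exact (isSymplecticOfRankTwo_n5_5 K).of_equiv e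
  · exact (isSymplecticOfRankTwo_n3_1_n3_1 K).of_equiv e

variable {K : Type*} [Field K] [CharZero K] {L : Type*} [LieRing L] [LieAlgebra K L]

theorem IsSymplecticOfRankTwo.pencil_or_free (h : IsSymplecticOfRankTwo K L) :
    (∃ (w₁ w₂ : L) (e₁ e₂ a b d : Dual K L), PencilForm w₁ w₂ e₁ e₂ a b d) ∨
    ∃ (w : Fin 3 → L) (f g k : Dual K L), LinearIndependent K w ∧
      LinearIndependent K ![f, g, k] ∧ (∀ i, f (w i) = 0 ∧ g (w i) = 0 ∧ k (w i) = 0) ∧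
      ∀ x y : L, ⁅x, y⁆ = wedge f g x y • w 0 + wedge f k x y • w 1 + wedge g k x y • w 2 := by
  have : FiniteDimensional K L := FiniteDimensional.of_finrank_pos (by rw [h.finrank_eq]; omega)
  refine h.span_or_free.imp_left ?_
  rintro ⟨x, u, v, hli, hspan⟩
  exact ⟨_, _, h.symplectic.exists_pencilForm hli hspan ⟨_, _, rfl⟩ ⟨_, _, rfl⟩
    (fun y => h.lie_lie y x u) (fun y => h.lie_lie y x v)⟩

theorem IsSymplecticOfRankTwo.isDecomposable (h : IsSymplecticOfRankTwo K L) :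
    IsDecomposable K L := by
  rcases h.pencil_or_free with ⟨w₁, w₂, e₁, e₂, a, b, d, hp⟩ | ⟨w, f, g, k, hw, -, -, hbr⟩
  · exact hp.isDecomposable h.finrank_eq
  · have hL := h.finrank_eq
    have : FiniteDimensional K L := FiniteDimensional.of_finrank_pos (by omega)
    refine isDecomposable_of_functionals ![f, g, k] w hw (fun x y => ?_) (fun x hx y => ?_)
      (by omega) (by omega)
    · rw [hbr]
      refine Submodule.add_mem _ (Submodule.add_mem _ ?_ ?_) ?_ <;>
        exact Submodule.smul_mem _ _ (Submodule.subset_span ⟨_, rfl⟩)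
    · simp [Fin.forall_fin_succ] at hx
      simp [hbr, wedge, hx]

/-- The classification over a field of characteristic zero: besides the common list there are the
pencils with `d = μ a`. -/
theorem IsSymplecticOfRankTwo.classification (h : IsSymplecticOfRankTwo K L) :
    IsInCommonList K L ∨ ∃ (w₁ w₂ : L) (e₁ e₂ a b : Dual K L) (μ : K), μ ≠ 0 ∧
      PencilForm w₁ w₂ e₁ e₂ a b (μ • a) ∧ LinearIndependent K ![e₁, e₂, a, b] := by
  have hL := h.finrank_eq
  rcases h.pencil_or_free with ⟨w₁, w₂, e₁, e₂, a, b, d, hp⟩ | ⟨w, f, g, k, hw, hli, hv, hbr⟩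
  · by_cases h5 : LinearIndependent K ![e₁, e₂, a, b, d]
    · exact Or.inl (Or.inl (hp.nonempty_n7_124 hL h5))
    · obtain ⟨w₁, w₂, e₁, e₂, a, b, μ, hp⟩ := hp.exists_diagonal h5
      by_cases h4 : LinearIndependent K ![e₁, e₂, a, b]
      · by_cases hμ : μ = 0
        · exact Or.inl (Or.inr (Or.inl (hp.nonempty_n6_19 hL h4 hμ)))
        · exact Or.inr ⟨w₁, w₂, e₁, e₂, a, b, μ, hμ, hp, h4⟩
      · exact Or.inl (Or.inr (Or.inr (Or.inr (Or.inl (hp.nonempty_n5_5 hL h4)))))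
  · exact Or.inl (Or.inr (Or.inr (Or.inl (nonempty_n6_20 hw hli hv hbr hL))))

theorem IsInComponentOne.isDecomposable {K : Type*} [Field K] {L : Type*} [LieRing L]
    [LieAlgebra K L] (h : IsInComponentOne K L) (hs : IsSymplectic K L) : IsDecomposable K L := by
  obtain ⟨X, a₃, a₅, h1, h2, h3, h4, h5, h6⟩ := h
  have hL : finrank K L = 8 := by rw [finrank_eq_card_basis X, Fintype.card_fin]
  have : FiniteDimensional K L := FiniteDimensional.of_finrank_pos (by omega)
  have hc : ∀ i, (∀ j, ⁅X i, X j⁆ = 0) → ∀ x : L, ⁅x, X i⁆ = 0 := by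
    intro i hi x
    have : LieAlgebra.ad K L (X i) = 0 := X.ext fun j => by simpa using hi j
    have h0 : ⁅X i, x⁆ = 0 := LinearMap.congr_fun this x
    rw [← lie_skew, h0, neg_zero]
  have c3 := hc 2 h5
  have c5 := hc 4 h6
  have hw : LinearIndependent K ![X 2, X 4] := by
    have h7 := X.linearIndependent.comp ![2, 4] (by decide)
    have h8 : ![X 2, X 4] = X ∘ ![2, 4] := by
      ext i
      fin_cases i <;> rfl
    rwa [h8]
  have m3 : X 2 ∈ Submodule.span K {X 2, X 4} := Submodule.subset_span (by simp)
  have m5 : X 4 ∈ Submodule.span K {X 2, X 4} := Submodule.subset_span (by simp)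
  have hnum : ∀ j : Fin 8, j = 0 ∨ j = 2 ∨ j = 4 ∨ j ∈ ({1, 3, 5, 6, 7} : Set (Fin 8)) := by
    intro j
    fin_cases j <;> simp
  have h0 : ∀ j : Fin 8, ⁅X 0, X j⁆ ∈ Submodule.span K {X 2, X 4} := by
    intro j
    fin_cases j
    · simp
    · simpa [h1] using m3
    · simp [c3]
    · simpa [h2] using m5
    · simp [c5]
    · simp [h3 5 (by simp)]
    · simp [h3 6 (by simp)]
    · simp [h3 7 (by simp)]
  have hbasis : ∀ i j, ⁅X i, X j⁆ ∈ Submodule.span K {X 2, X 4} := by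
    intro i j
    rcases hnum i with rfl | rfl | rfl | hi
    · exact h0 j
    · simp [h5]
    · simp [h6]
    · rcases hnum j with rfl | rfl | rfl | hj
      · rw [← lie_skew]
        exact Submodule.neg_mem _ (h0 i)
      · simp [c3]
      · simp [c5]
      · rw [h4 i hi j hj]
        exact Submodule.add_mem _ (Submodule.smul_mem _ _ m3) (Submodule.smul_mem _ _ m5)
  -- Membership in the component makes X₃, X₅ a basis of the derived algebra, so the pencil form
  -- applies without any rank hypothesis.
  have hspan : ∀ x y : L, ⁅x, y⁆ ∈ Submodule.span K {X 2, X 4} := by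
    intro x y
    rw [← X.sum_repr x, ← X.sum_repr y]
    simp only [sum_lie, lie_sum, lie_smul, smul_lie]
    exact Submodule.sum_mem _ fun i _ => Submodule.smul_mem _ _
      (Submodule.sum_mem _ fun j _ => Submodule.smul_mem _ _ (hbasis _ _))
  obtain ⟨e₁, e₂, a, b, d, hp⟩ := hs.exists_pencilForm hw (fun x y => by
    obtain ⟨s, t, h⟩ := Submodule.mem_span_pair.1 (hspan x y)
    exact ⟨s, t, h.symm⟩) ⟨_, _, h1⟩ ⟨_, _, h2⟩ c3 c5
  exact hp.isDecomposable hL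

end Main

end SympLie

theorem mainTheorem2 :
    (∀ (K : Type*) [RCLike K] (L : Type*) [LieRing L] [LieAlgebra K L],
      SympLie.IsSymplecticOfType221111 K L → SympLie.IsDecomposable K L) ∧
    (∀ (K : Type*) [RCLike K] (L : Type*) [LieRing L] [LieAlgebra K L],
      SympLie.IsInComponentOne K L → SympLie.IsSymplectic K L → SympLie.IsDecomposable K L) ∧
    (∀ (L : Type*) [LieRing L] [LieAlgebra ℂ L],
      SympLie.IsSymplecticOfType221111 ℂ L ↔ SympLie.IsInCommonList ℂ L) ∧
    (∀ (L : Type*) [LieRing L] [LieAlgebra ℝ L],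
      SympLie.IsSymplecticOfType221111 ℝ L ↔
        (SympLie.IsInCommonList ℝ L ∨
          Nonempty (L ≃ₗ⁅ℝ⁆ SympLie.N6_20_1 ℝ × SympLie.Ab ℝ 2))) := by
  refine ⟨fun K _ L _ _ h => ?_, fun K _ L _ _ h hs => h.isDecomposable hs, fun L _ _ => ?_,
    fun L _ _ => ?_⟩
  · exact (SympLie.isSymplecticOfType_iff.1 h).isDecomposable
  · rw [SympLie.isSymplecticOfType_iff]
    refine ⟨fun h => ?_, fun h => h.isSymplecticOfRankTwo⟩
    rcases h.classification with h' | ⟨w₁, w₂, e₁, e₂, a, b, μ, hμ, hp, hli⟩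
    · exact h'
    · obtain ⟨k, hk⟩ := IsAlgClosed.exists_pow_nat_eq μ (n := 2) (by norm_num)
      exact Or.inr (Or.inr (Or.inr (Or.inr (hp.nonempty_n3_1_n3_1 h.finrank_eq hli
        (by rintro rfl; simp_all) hk.symm))))
  · rw [SympLie.isSymplecticOfType_iff]
    constructor
    · intro h
      rcases h.classification with h' | ⟨w₁, w₂, e₁, e₂, a, b, μ, hμ, hp, hli⟩
      · exact Or.inl h'
      -- Over ℝ the sign of μ decides: a negative μ is -k², which gives the extra real algebra, and
      -- a positive μ is k².
      · rcases lt_or_gt_of_ne hμ with hneg | hpos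
        · exact Or.inr (hp.nonempty_n6_20_1 h.finrank_eq hli (k := √(-μ))
            (Real.sqrt_ne_zero'.2 (by linarith)) (by rw [Real.sq_sqrt (by linarith), neg_neg]))
        · exact Or.inl (Or.inr (Or.inr (Or.inr (Or.inr (hp.nonempty_n3_1_n3_1 h.finrank_eq hli
            (k := √μ) (Real.sqrt_ne_zero'.2 hpos) (Real.sq_sqrt hpos.le).symm)))))
    · rintro (h | ⟨⟨e⟩⟩)
      · exact h.isSymplecticOfRankTwo
      · exact (SympLie.isSymplecticOfRankTwo_n6_20_1 ℝ).of_equiv e
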